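/- All vector spaces, algebras and tensor products are over $\mathbb{C}$. Let $\mathfrak g=\mathfrak g(C)$ be the Kac–Moody Lie algebra of an arbitrary generalized Cartan matrix $C$ (with a realization of $C$; symmetrizability is not assumed), with Cartan subalgebra $\mathfrak h$ and standard triangular decomposition $\mathfrak g=N^-\oplus\mathfrak h\oplus N^+$. Put $\mathfrak g'=[\mathfrak g,\mathfrak g]$, $\mathfrak h'=\mathfrak h\cap\mathfrak g'$, and fix a subspace $\mathfrak h''$ of $\mathfrak h$ with $\mathfrak h=\mathfrak h'\oplus\mathfrak h''$. Let $A=\mathbb{C}[t_1^{\pm1},\dots,t_n^{\pm1}]$, and let $$\mathfrak g_A=(\mathfrak g'\otimes A)\oplus\mathfrak h'',\qquad \mathfrak h_A=(\mathfrak h'\otimes A)\oplus\mathfrak h''$$ with bracket $[X\otimes p,Y\otimes q]=[X,Y]\otimes pq$, $[h,X\otimes p]=[h,X]\otimes p$, $[h,k]=0$ for $X,Y\in\mathfrak g'$, $p,q\in A$, $h,k\in\mathfrak h''$. For a linear map $\psi:\mathfrak h_A\to\mathbb{C}$ let $M(\psi)=U(\mathfrak g_A)\otimes_{U((N^+\otimes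 A)\oplus\mathfrak h_A)}\mathbb{C}$, where $N^+\otimes A$ acts on $\mathbb{C}$ by $0$ and $\mathfrak h_A$ acts via $\psi$, and let $V(\psi)$ be the unique irreducible quotient of the $\mathfrak g_A$-module $M(\psi)$, that is, its quotient by its largest proper submodule. Let $I_1$ and $I_2$ be ideals of $A$ of finite codimension with $I_1+I_2=A$, and let $\psi_1,\psi_2:\mathfrak h_A\to\mathbb{C}$ be linear maps such that $\psi_i(\mathfrak h'\otimes I_i)=0$ for $i=1,2$. Then $$V(\psi_1+\psi_2)\cong V(\psi_1)\otimes V(\psi_2)$$ as $\mathfrak g_A$-modules. -/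

import Mathlib

open scoped TensorProduct

noncomputable section

namespace LoopKacMoody

/-! ### Generalized Cartan matrices and their realizations -/

/-- Generalized Cartan matrices (not assumed symmetrizable). -/
structure IsGCM {ι : Type*} (C : Matrix ι ι ℤ) : Prop where
  diag : ∀ i, C i i = 2
  nonpos : ∀ i j, i ≠ j → C i j ≤ 0
  zero_symm : ∀ i j, C i j = 0 → C j i = 0

/-- A (minimal) realization of a complex matrix given by integers: a finite dimensional space `H`,
linearly independent simple coroots in `H` and simple roots in the dual of `H`, with
`⟨coroot i, root j⟩ = C i j` and `dim H - l = l - rank C`, where `l` is the size of `C`. -/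
structure Realization {ι : Type*} [Fintype ι] [DecidableEq ι] (C : Matrix ι ι ℤ)
    (H : Type*) [AddCommGroup H] [Module ℂ H] where
  finite : Module.Finite ℂ H
  coroot : ι → H
  root : ι → Module.Dual ℂ H
  coroot_indep : LinearIndependent ℂ coroot
  root_indep : LinearIndependent ℂ root
  pairing : ∀ i j, root j (coroot i) = (C i j : ℂ)
  dim_eq : Module.finrank ℂ H + (C.map (Int.cast : ℤ → ℂ)).rank = 2 * Fintype.card ι

/-- Generators of the auxiliary Lie algebra: `e i`, `f i`, and all elements of `H`. -/
inductive Gen (ι H : Type*)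
  | e : ι → Gen ι H
  | f : ι → Gen ι H
  | h : H → Gen ι H

section KacMoodyAlgebra

variable {ι : Type*} [Fintype ι] [DecidableEq ι] {C : Matrix ι ι ℤ}
  {H : Type*} [AddCommGroup H] [Module ℂ H]

/-- The free generators. -/
abbrev fe (H : Type*) {ι : Type*} (i : ι) : FreeLieAlgebra ℂ (Gen ι H) :=
  FreeLieAlgebra.of ℂ (Gen.e i)

/-- The free generators. -/
abbrev ff (H : Type*) {ι : Type*} (i : ι) : FreeLieAlgebra ℂ (Gen ι H) :=
  FreeLieAlgebra.of ℂ (Gen.f i)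

/-- The free generators. -/
abbrev fh (ι : Type*) {H : Type*} (x : H) : FreeLieAlgebra ℂ (Gen ι H) :=
  FreeLieAlgebra.of ℂ (Gen.h x)

/-- The defining relations of the auxiliary Lie algebra (each element listed is set to zero).
The first two families make `H → (auxiliary algebra)` linear. -/
inductive Rel (R : Realization C H) : FreeLieAlgebra ℂ (Gen ι H) → Prop
  | add (x y : H) : Rel R (fh ι (x + y) - fh ι x - fh ι y)
  | smul (c : ℂ) (x : H) : Rel R (fh ι (c • x) - c • fh ι x)
  | hh (x y : H) : Rel R ⁅fh ι x, fh ι y⁆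
  | ef (i : ι) : Rel R (⁅fe H i, ff H i⁆ - fh ι (R.coroot i))
  | ef_ne (i j : ι) (hij : i ≠ j) : Rel R ⁅fe H i, ff H j⁆
  | he (x : H) (i : ι) : Rel R (⁅fh ι x, fe H i⁆ - R.root i x • fe H i)
  | hf (x : H) (i : ι) : Rel R (⁅fh ι x, ff H i⁆ + R.root i x • ff H i)

/-- The auxiliary Lie algebra, presented by generators and relations. -/
def Aux (R : Realization C H) : Type _ :=
  FreeLieAlgebra ℂ (Gen ι H) ⧸ LieSubmodule.lieSpan ℂ (FreeLieAlgebra ℂ (Gen ι H)) {x | Rel R x}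

instance (R : Realization C H) : LieRing (Aux R) :=
  inferInstanceAs (LieRing (FreeLieAlgebra ℂ (Gen ι H) ⧸
    LieSubmodule.lieSpan ℂ (FreeLieAlgebra ℂ (Gen ι H)) {x | Rel R x}))
instance (R : Realization C H) : LieAlgebra ℂ (Aux R) :=
  inferInstanceAs (LieAlgebra ℂ (FreeLieAlgebra ℂ (Gen ι H) ⧸
    LieSubmodule.lieSpan ℂ (FreeLieAlgebra ℂ (Gen ι H)) {x | Rel R x}))

/-- The projection from the free Lie algebra. -/
def auxMk (R : Realization C H) : FreeLieAlgebra ℂ (Gen ι H) →ₗ⁅ℂ⁆ Aux R where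
  toLinearMap := (LieSubmodule.Quotient.mk'
    (LieSubmodule.lieSpan ℂ (FreeLieAlgebra ℂ (Gen ι H)) {x | Rel R x})).toLinearMap
  map_lie' := rfl

/-- The linear map from `H` to the auxiliary Lie algebra. -/
def auxCartanMap (R : Realization C H) : H →ₗ[ℂ] Aux R where
  toFun x := auxMk R (fh ι x)
  map_add' x y := by
    have h : auxMk R (fh ι (x + y) - fh ι x - fh ι y) = 0 :=
      (LieSubmodule.Quotient.mk_eq_zero _).2 (LieSubmodule.subset_lieSpan (Rel.add x y))
    rw [map_sub, map_sub, sub_sub, sub_eq_zero] at h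
    exact h
  map_smul' c x := by
    have h : auxMk R (fh ι (c • x) - c • fh ι x) = 0 :=
      (LieSubmodule.Quotient.mk_eq_zero _).2 (LieSubmodule.subset_lieSpan (Rel.smul c x))
    rw [map_sub, map_smul, sub_eq_zero] at h
    exact h

/-- The largest ideal of the auxiliary Lie algebra meeting the image of `H` trivially. -/
def radical (R : Realization C H) : LieIdeal ℂ (Aux R) :=
  sSup {J | J.toSubmodule ⊓ (auxCartanMap R).range = ⊥}

/-- The Kac-Moody Lie algebra `𝔤`. -/
def KM (R : Realization C H) : Type _ := Aux R ⧸ radical R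

instance (R : Realization C H) : LieRing (KM R) :=
  inferInstanceAs (LieRing (Aux R ⧸ radical R))
instance (R : Realization C H) : LieAlgebra ℂ (KM R) :=
  inferInstanceAs (LieAlgebra ℂ (Aux R ⧸ radical R))

/-- The projection from the auxiliary Lie algebra to the Kac-Moody algebra. -/
def kmMk (R : Realization C H) : Aux R →ₗ⁅ℂ⁆ KM R where
  toLinearMap := (LieSubmodule.Quotient.mk' (radical R)).toLinearMap
  map_lie' := rfl

/-- The Cartan subalgebra `𝔥` of `𝔤`, the image of `H`. -/
def cartan (R : Realization C H) : Submodule ℂ (KM R) :=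
  ((kmMk R : Aux R →ₗ[ℂ] KM R) ∘ₗ auxCartanMap R).range

/-- The derived algebra `𝔤' = [𝔤, 𝔤]`. -/
def derived (R : Realization C H) : LieIdeal ℂ (KM R) :=
  ⁅(⊤ : LieIdeal ℂ (KM R)), (⊤ : LieIdeal ℂ (KM R))⁆

/-- `𝔥' = 𝔥 ∩ 𝔤'`. -/
def cartan' (R : Realization C H) : Submodule ℂ (KM R) :=
  cartan R ⊓ (derived R).toSubmodule

/-- `N⁺`, the subalgebra generated by the positive Chevalley generators. -/
def nPlus (R : Realization C H) : LieSubalgebra ℂ (KM R) :=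
  LieSubalgebra.lieSpan ℂ (KM R) (Set.range fun i : ι => kmMk R (auxMk R (fe H i)))

/-! ### The loop Kac-Moody algebra -/

/-- Laurent polynomials over `ℂ` in `n` commuting variables: the group algebra of `ℤⁿ`. -/
abbrev Laurent (n : ℕ) : Type := AddMonoidAlgebra ℂ (Fin n → ℤ)

/-- For a subspace `W` of `𝔤`, the subspace `W ⊗ A` of `𝔤 ⊗ A` (written as `A ⊗ 𝔤`). -/
def tensorSub (n : ℕ) {R : Realization C H} (W : Submodule ℂ (KM R)) :
    Submodule ℂ (Laurent n ⊗[ℂ] KM R) :=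
  (W.baseChange (Laurent n)).restrictScalars ℂ

/-- For a subspace `W` of `𝔤`, the subspace `W ⊗ 1` of `𝔤 ⊗ A`. -/
def constSub (n : ℕ) {R : Realization C H} (W : Submodule ℂ (KM R)) :
    Submodule ℂ (Laurent n ⊗[ℂ] KM R) :=
  W.map (TensorProduct.mk ℂ (Laurent n) (KM R) 1)

lemma lie_mem_tensorSub (n : ℕ) {R : Realization C H} (x y : Laurent n ⊗[ℂ] KM R) :
    ⁅x, y⁆ ∈ tensorSub n (derived R).toSubmodule := by
  induction x using TensorProduct.induction_on with
  | zero => rw [show ⁅(0 : Laurent n ⊗[ℂ] KM R), y⁆ = 0 from zero_lie y]; exact zero_mem _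
  | add a b ha hb => rw [show ⁅a + b, y⁆ = ⁅a, y⁆ + ⁅b, y⁆ from add_lie a b y]; exact add_mem ha hb
  | tmul p X =>
    induction y using TensorProduct.induction_on with
    | zero => rw [show ⁅p ⊗ₜ[ℂ] X, (0 : Laurent n ⊗[ℂ] KM R)⁆ = 0 from lie_zero (p ⊗ₜ[ℂ] X)]; exact zero_mem _
    | add a b ha hb => rw [show ⁅p ⊗ₜ[ℂ] X, a + b⁆ = ⁅p ⊗ₜ[ℂ] X, a⁆ + ⁅p ⊗ₜ[ℂ] X, b⁆ from lie_add (p ⊗ₜ[ℂ] X) a b]; exact add_mem ha hb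
    | tmul q Y =>
      rw [LieAlgebra.ExtendScalars.bracket_tmul]
      exact Submodule.tmul_mem_baseChange_of_mem _
        (LieSubmodule.lie_mem_lie (LieSubmodule.mem_top X) (LieSubmodule.mem_top Y))

/-- The loop Kac-Moody algebra `𝔤_A = 𝔤' ⊗ A ⊕ 𝔥''`, realized inside `𝔤 ⊗ A` with `𝔥''` identified
with `𝔥'' ⊗ 1` (the sum is direct when `𝔥''` is a complement of `𝔥'` in `𝔥`, as then
`𝔥'' ∩ 𝔤' = 0`).  The bracket of `𝔤 ⊗ A` is `[X ⊗ p, Y ⊗ q] = [X, Y] ⊗ p q`, so that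
`[h, X ⊗ p] = [h, X] ⊗ p` for `h` in `𝔥''`. -/
def gA (n : ℕ) (R : Realization C H) (W : Submodule ℂ (KM R)) :
    LieSubalgebra ℂ (Laurent n ⊗[ℂ] KM R) where
  toSubmodule := tensorSub n (derived R).toSubmodule ⊔ constSub n W
  lie_mem' := fun {x y} _ _ => Submodule.mem_sup_left (lie_mem_tensorSub n x y)

/-- `𝔥_A = 𝔥' ⊗ A ⊕ 𝔥''` as a subspace of `𝔤_A`. -/
def hA (n : ℕ) (R : Realization C H) (W : Submodule ℂ (KM R)) : Submodule ℂ (gA n R W) :=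
  (tensorSub n (cartan' R) ⊔ constSub n W).comap (gA n R W).toSubmodule.subtype

/-- `N⁺ ⊗ A` as a subspace of `𝔤_A`. -/
def nA (n : ℕ) (R : Realization C H) (W : Submodule ℂ (KM R)) : Submodule ℂ (gA n R W) :=
  (tensorSub n (nPlus R).toSubmodule).comap (gA n R W).toSubmodule.subtype

/-- The element `h ⊗ p` of `𝔥_A`, for `h` in `𝔥'` and `p` in `A`. -/
def hTensor {n : ℕ} {R : Realization C H} (W : Submodule ℂ (KM R))
    (h : cartan' R) (p : Laurent n) : hA n R W :=
  ⟨⟨p ⊗ₜ[ℂ] (h : KM R),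
    Submodule.mem_sup_left (Submodule.tmul_mem_baseChange_of_mem p h.2.2)⟩,
    Submodule.mem_sup_left (Submodule.tmul_mem_baseChange_of_mem p h.2)⟩

/-! ### Highest weight modules -/

attribute [local instance 100] LieRing.ofAssociativeRing

variable {n : ℕ} {R : Realization C H} {W : Submodule ℂ (KM R)}

/-- The universal enveloping algebra `U(𝔤_A)`. -/
abbrev UgA (n : ℕ) (R : Realization C H) (W : Submodule ℂ (KM R)) : Type _ :=
  UniversalEnvelopingAlgebra ℂ (gA n R W)

/-- The left ideal of `U(𝔤_A)` generated by `N⁺ ⊗ A` and by all `h - ψ(h) 1` with `h` in `𝔥_A`. -/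
def vermaIdeal (ψ : hA n R W →ₗ[ℂ] ℂ) : Submodule (UgA n R W) (UgA n R W) :=
  Submodule.span (UgA n R W)
    ({u | ∃ x ∈ nA n R W, u = UniversalEnvelopingAlgebra.ι ℂ x} ∪
     {u | ∃ h : hA n R W, u = UniversalEnvelopingAlgebra.ι ℂ (h : gA n R W) -
        algebraMap ℂ (UgA n R W) (ψ h)})

/-- The induced module `M(ψ) = U(𝔤_A) ⊗_{U(𝔟)} ℂ`, where `𝔟 = (N⁺ ⊗ A) ⊕ 𝔥_A` acts on `ℂ` through
`0` on `N⁺ ⊗ A` and through `ψ` on `𝔥_A`.  As the inducing module is cyclic, with annihilator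
generated by `N⁺ ⊗ A` and the `h - ψ(h) 1`, this tensor product is the quotient of `U(𝔤_A)` by the
left ideal generated by these elements. -/
def M (ψ : hA n R W →ₗ[ℂ] ℂ) : Type _ := UgA n R W ⧸ vermaIdeal ψ

instance (ψ : hA n R W →ₗ[ℂ] ℂ) : AddCommGroup (M ψ) :=
  inferInstanceAs (AddCommGroup (UgA n R W ⧸ vermaIdeal ψ))
instance (ψ : hA n R W →ₗ[ℂ] ℂ) : Module (UgA n R W) (M ψ) :=
  inferInstanceAs (Module (UgA n R W) (UgA n R W ⧸ vermaIdeal ψ))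
instance (ψ : hA n R W →ₗ[ℂ] ℂ) : Module ℂ (M ψ) :=
  inferInstanceAs (Module ℂ (UgA n R W ⧸ vermaIdeal ψ))
instance (ψ : hA n R W →ₗ[ℂ] ℂ) : IsScalarTower ℂ (UgA n R W) (M ψ) :=
  inferInstanceAs (IsScalarTower ℂ (UgA n R W) (UgA n R W ⧸ vermaIdeal ψ))

/-- The largest proper submodule of `M(ψ)` (the sum of all proper submodules). -/
def maxSubmodule (ψ : hA n R W →ₗ[ℂ] ℂ) : Submodule (UgA n R W) (M ψ) :=
  sSup {N | N ≠ ⊤}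

/-- The unique irreducible quotient `V(ψ)` of `M(ψ)`. -/
def V (ψ : hA n R W →ₗ[ℂ] ℂ) : Type _ := M ψ ⧸ maxSubmodule ψ

instance (ψ : hA n R W →ₗ[ℂ] ℂ) : AddCommGroup (V ψ) :=
  inferInstanceAs (AddCommGroup (M ψ ⧸ maxSubmodule ψ))
instance (ψ : hA n R W →ₗ[ℂ] ℂ) : Module (UgA n R W) (V ψ) :=
  inferInstanceAs (Module (UgA n R W) (M ψ ⧸ maxSubmodule ψ))
instance (ψ : hA n R W →ₗ[ℂ] ℂ) : Module ℂ (V ψ) :=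
  inferInstanceAs (Module ℂ (M ψ ⧸ maxSubmodule ψ))
instance (ψ : hA n R W →ₗ[ℂ] ℂ) : IsScalarTower ℂ (UgA n R W) (V ψ) :=
  inferInstanceAs (IsScalarTower ℂ (UgA n R W) (M ψ ⧸ maxSubmodule ψ))

/-- `V(ψ)` as a `𝔤_A`-module: `x` acts as its image in `U(𝔤_A)`. -/
instance (ψ : hA n R W →ₗ[ℂ] ℂ) : LieRingModule (gA n R W) (V ψ) where
  bracket x v := UniversalEnvelopingAlgebra.ι ℂ x • v
  add_lie x y v := by
    change UniversalEnvelopingAlgebra.ι ℂ (x + y) • v = _ • v + _ • v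
    rw [map_add, add_smul]
  lie_add x v w := smul_add _ v w
  leibniz_lie x y v := by
    change UniversalEnvelopingAlgebra.ι ℂ x • UniversalEnvelopingAlgebra.ι ℂ y • v =
      UniversalEnvelopingAlgebra.ι ℂ ⁅x, y⁆ • v +
        UniversalEnvelopingAlgebra.ι ℂ y • UniversalEnvelopingAlgebra.ι ℂ x • v
    rw [LieHom.map_lie, LieRing.of_associative_ring_bracket, sub_smul, mul_smul, mul_smul,
      sub_add_cancel]

lemma lie_def (ψ : hA n R W →ₗ[ℂ] ℂ) (x : gA n R W) (v : V ψ) :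
    ⁅x, v⁆ = UniversalEnvelopingAlgebra.ι ℂ x • v := rfl

instance (ψ : hA n R W →ₗ[ℂ] ℂ) : LieModule ℂ (gA n R W) (V ψ) where
  smul_lie c x v := by rw [lie_def, lie_def, map_smul, smul_assoc]
  lie_smul c x v := by
    rw [lie_def, lie_def, ← algebraMap_smul (UgA n R W) c v, ← mul_smul,
      ← Algebra.commutes, mul_smul, algebraMap_smul]

end KacMoodyAlgebra

end LoopKacMoody

end

/-! The algebra `𝔤_A` is generated by raising elements `e_i ⊗ p`, lowering elements `f_i ⊗ p` and
the abelian diagonal part `𝔥_A`, with simple commutation relations (`TriData`). An irreducible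
highest weight module is characterized by its highest weight vector `v` being nonzero, generating
under the lowering operators, and spanning all singular vectors (`TriData.SimpleHW`). No Serre
relation or invariant form is needed.

If `ψ` kills `𝔥' ⊗ I`, then in the irreducible module every `e_i ⊗ p` and `f_i ⊗ p` with `p ∈ I`
acts by zero: the subspace generated by the images of such `f_i ⊗ p` is stable under raising and has
no component along `v`, so it vanishes (`TriData.SimpleHW.eq_zero_of_mem`). As `I₁ + I₂ = A`, write
`p = a + b` with `a ∈ I₁`, `b ∈ I₂`. On `V(ψ₁) ⊗ V(ψ₂)` the elements with coefficient `b` act as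
those with coefficient `p` on the first factor alone, and `a` does the same for the second. So `v₁ ⊗
v₂` generates, and a singular vector is singular in each factor separately, hence a multiple of `v₁
⊗ v₂` (`TriData.SimpleHW.tensor`). Uniqueness of the irreducible module of given highest weight
(`exists_V_equiv`) concludes.

It remains to see that `V(ψ)` is itself such a module, in particular nonzero. Instead of the
Poincaré–Birkhoff–Witt theorem, a model is built on the free algebra on the lowering generators,
divided by its largest raising-stable subspace without constant terms (`free_simpleHW`). Its
operators satisfy only the relations among generators. They extend to `𝔤_A` because the Lie algebra
generated by the pairs (generator, operator) projects bijectively onto `𝔤_A`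
(`TriData.SimpleHW.exists_lieHom`).

Gradings enter only through an element `d` on which all simple roots equal one: "having no component
of eigenvalue `c`" is expressed by `offEigen`. -/

noncomputable section

namespace LoopKacMoody

attribute [local instance 100] LieRing.ofAssociativeRing

/-! ### Vectors without component at an eigenvalue -/

section OffEigen

open Polynomial

variable {V : Type*} [AddCommGroup V] [Module ℂ V]

/-- The vectors killed by a polynomial in `T` that does not vanish at `c`. -/
def offEigen (T : Module.End ℂ V) (c : ℂ) : Submodule ℂ V where
  carrier := {w | ∃ P : ℂ[X], P.eval c ≠ 0 ∧ aeval T P w = 0}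
  zero_mem' := ⟨1, by simp, by simp⟩
  add_mem' := by
    rintro a b ⟨P, hP, hPa⟩ ⟨Q, hQ, hQb⟩
    refine ⟨P * Q, by simp [hP, hQ], ?_⟩
    rw [map_add, map_mul, Module.End.mul_apply, Module.End.mul_apply, hQb, map_zero, add_zero,
      ← Module.End.mul_apply, ← map_mul, mul_comm, map_mul, Module.End.mul_apply, hPa, map_zero]
  smul_mem' := by
    rintro k a ⟨P, hP, hPa⟩
    exact ⟨P, hP, by rw [map_smul, hPa, smul_zero]⟩

lemma mem_offEigen_of_eigen {T : Module.End ℂ V} {c μ : ℂ} {w : V} (h : T w = μ • w)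
    (hne : μ ≠ c) : w ∈ offEigen T c :=
  ⟨X - C μ, by simpa [sub_eq_zero] using hne.symm, by simp [h]⟩

lemma map_mem_offEigen {V' : Type*} [AddCommGroup V'] [Module ℂ V'] {T : Module.End ℂ V}
    {T' : Module.End ℂ V'} {c : ℂ} {π : V →ₗ[ℂ] V'} (hπ : ∀ w, π (T w) = T' (π w)) {w : V}
    (hw : w ∈ offEigen T c) : π w ∈ offEigen T' c := by
  obtain ⟨P, hP, hPw⟩ := hw
  refine ⟨P, hP, ?_⟩
  have key : ∀ w, π (aeval T P w) = aeval T' P (π w) := by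
    clear hP hPw
    induction P using Polynomial.induction_on' with
    | add p q hp hq => exact fun w => by simp [hp, hq]
    | monomial k a =>
      have hk : ∀ w, π ((T ^ k) w) = (T' ^ k) (π w) := by
        induction k with
        | zero => simp
        | succ k ih => intro w; rw [pow_succ, pow_succ, Module.End.mul_apply, ih, hπ]; rfl
      intro w
      simp [aeval_monomial, ← Algebra.smul_def, hk]
  rw [← key, hPw, map_zero]

/-- On a `c`-eigenvector, `P(T)` is multiplication by the nonzero scalar `P(c)`. -/
lemma eq_zero_of_mem_offEigen {T : Module.End ℂ V} {c : ℂ} {w : V} (h : T w = c • w)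
    (hw : w ∈ offEigen T c) : w = 0 := by
  obtain ⟨P, hP, hPw⟩ := hw
  rw [Module.End.aeval_apply_of_mem_apply_eq_smul h, smul_eq_zero] at hPw
  exact hPw.resolve_left hP

end OffEigen

/-! ### Triangular generators and relations -/

/-- Combinatorial data of a triangular presentation: an index set `X` for raising and lowering
generators and an index set `Z` for diagonal generators, `z` sending the raising generator `x` to
`act z x`, and `[e x, f y]` being the diagonal generator of index `t x y`; the diagonal generator
of index `d` gives the principal grading. -/
structure TriData (X Z : Type*) where
  act : Z → X → X
  t : X → X → Z
  d : Z
  -- These two identities reflect the Jacobi identity for two diagonal and one raising generator,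
  -- and for one generator of each kind. They make the operators on the free algebra satisfy the
  -- relations.
  act_comm : ∀ z z' x, act z (act z' x) = act z' (act z x)
  t_act : ∀ z x y, t (act z x) y = t x (act z y)
  act_d : ∀ x, act d x = x

variable {X Z : Type*}

/-- Elements of a Lie algebra satisfying the relations of `D`. -/
structure TriData.Rels (D : TriData X Z) {L : Type*} [LieRing L] (e f : X → L) (h : Z → L) :
    Prop where
  hh : ∀ z z', ⁅h z, h z'⁆ = 0
  he : ∀ z x, ⁅h z, e x⁆ = e (D.act z x)
  hf : ∀ z x, ⁅h z, f x⁆ = -f (D.act z x)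
  ef : ∀ x y, ⁅e x, f y⁆ = h (D.t x y)

namespace TriData.Rels

variable {D : TriData X Z} {L : Type*} [LieRing L] [LieAlgebra ℂ L] {e f : X → L} {h : Z → L}

lemma map (r : D.Rels e f h) {L' : Type*} [LieRing L'] [LieAlgebra ℂ L'] (φ : L →ₗ⁅ℂ⁆ L') :
    D.Rels (fun x => φ (e x)) (fun x => φ (f x)) (fun z => φ (h z)) where
  hh z z' := by rw [← LieHom.map_lie, r.hh, map_zero]
  he z x := by rw [← LieHom.map_lie, r.he]
  hf z x := by rw [← LieHom.map_lie, r.hf, map_neg]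
  ef x y := by rw [← LieHom.map_lie, r.ef]

lemma lie_h_e_mem (r : D.Rels e f h) (z : Z) {a : L}
    (ha : a ∈ LieSubalgebra.lieSpan ℂ L (Set.range e)) :
    ⁅h z, a⁆ ∈ LieSubalgebra.lieSpan ℂ L (Set.range e) := by
  induction ha using LieSubalgebra.lieSpan_induction with
  | mem a ha =>
    obtain ⟨x, rfl⟩ := ha
    rw [r.he]
    exact LieSubalgebra.subset_lieSpan ⟨_, rfl⟩
  | zero => simp
  | smul c a _ ih => rw [lie_smul]; exact SMulMemClass.smul_mem c ih
  | add a b _ _ iha ihb => rw [lie_add]; exact add_mem iha ihb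
  | lie a b ha hb iha ihb =>
    rw [leibniz_lie]
    exact add_mem (LieSubalgebra.lie_mem _ iha hb) (LieSubalgebra.lie_mem _ ha ihb)

lemma lie_h_f_mem (r : D.Rels e f h) (z : Z) {a : L}
    (ha : a ∈ LieSubalgebra.lieSpan ℂ L (Set.range f)) :
    ⁅h z, a⁆ ∈ LieSubalgebra.lieSpan ℂ L (Set.range f) := by
  induction ha using LieSubalgebra.lieSpan_induction with
  | mem a ha =>
    obtain ⟨x, rfl⟩ := ha
    rw [r.hf]
    exact neg_mem (LieSubalgebra.subset_lieSpan ⟨_, rfl⟩)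
  | zero => simp
  | smul c a _ ih => rw [lie_smul]; exact SMulMemClass.smul_mem c ih
  | add a b _ _ iha ihb => rw [lie_add]; exact add_mem iha ihb
  | lie a b ha hb iha ihb =>
    rw [leibniz_lie]
    exact add_mem (LieSubalgebra.lie_mem _ iha hb) (LieSubalgebra.lie_mem _ ha ihb)

lemma span_h_lie_mem {s : LieSubalgebra ℂ L} (hs : ∀ z, ∀ a ∈ s, ⁅h z, a⁆ ∈ s) {b a : L}
    (hb : b ∈ Submodule.span ℂ (Set.range h)) (ha : a ∈ s) : ⁅b, a⁆ ∈ s := by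
  induction hb using Submodule.span_induction with
  | mem b hb => obtain ⟨z, rfl⟩ := hb; exact hs z a ha
  | zero => simp
  | smul c b _ ih => rw [smul_lie]; exact SMulMemClass.smul_mem c ih
  | add b c _ _ ihb ihc => rw [add_lie]; exact add_mem ihb ihc

/-- A raising or lowering generator `g` maps the opposite triangular part into the sum of that part
and the diagonal part. -/
lemma lie_opposite_mem {s : Set L} {g : L}
    (hs : ∀ z, ∀ a ∈ LieSubalgebra.lieSpan ℂ L s, ⁅h z, a⁆ ∈ LieSubalgebra.lieSpan ℂ L s)
    (hg : ∀ a ∈ s, ⁅g, a⁆ ∈ Submodule.span ℂ (Set.range h)) {a : L}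
    (ha : a ∈ LieSubalgebra.lieSpan ℂ L s) :
    ⁅g, a⁆ ∈ (LieSubalgebra.lieSpan ℂ L s).toSubmodule ⊔ Submodule.span ℂ (Set.range h) := by
  induction ha using LieSubalgebra.lieSpan_induction with
  | mem a ha => exact Submodule.mem_sup_right (hg a ha)
  | zero => simp
  | smul c a _ ih => rw [lie_smul]; exact Submodule.smul_mem _ c ih
  | add a b _ _ iha ihb => rw [lie_add]; exact add_mem iha ihb
  | lie a b ha hb iha ihb =>
    rw [leibniz_lie]
    obtain ⟨a₁, ha₁, a₂, ha₂, hae⟩ := Submodule.mem_sup.1 iha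
    obtain ⟨b₁, hb₁, b₂, hb₂, hbe⟩ := Submodule.mem_sup.1 ihb
    refine Submodule.mem_sup_left ?_
    rw [← hae, ← hbe, add_lie, lie_add, ← lie_skew a b₂]
    exact add_mem (add_mem (LieSubalgebra.lie_mem _ ha₁ hb) (span_h_lie_mem hs ha₂ hb))
      (add_mem (LieSubalgebra.lie_mem _ ha hb₁) (neg_mem (span_h_lie_mem hs hb₂ ha)))

/-- The triangular decomposition of the Lie subalgebra generated by the generators. -/
lemma lieSpan_le_triangular (r : D.Rels e f h) {a : L}
    (ha : a ∈ LieSubalgebra.lieSpan ℂ L (Set.range e ∪ Set.range f ∪ Set.range h)) :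
    a ∈ (LieSubalgebra.lieSpan ℂ L (Set.range f)).toSubmodule ⊔ Submodule.span ℂ (Set.range h) ⊔
      (LieSubalgebra.lieSpan ℂ L (Set.range e)).toSubmodule := by
  set N := LieSubalgebra.lieSpan ℂ L (Set.range f)
  set P := LieSubalgebra.lieSpan ℂ L (Set.range e)
  set T := Submodule.span ℂ (Set.range h)
  set S := N.toSubmodule ⊔ T ⊔ P.toSubmodule
  have hN : N.toSubmodule ≤ S := le_sup_left.trans le_sup_left
  have hT : T ≤ S := le_sup_right.trans le_sup_left
  have hP : P.toSubmodule ≤ S := le_sup_right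
  have ext : ∀ g : L, (∀ b ∈ N, ⁅g, b⁆ ∈ S) → (∀ b ∈ T, ⁅g, b⁆ ∈ S) → (∀ b ∈ P, ⁅g, b⁆ ∈ S) →
      ∀ b ∈ S, ⁅g, b⁆ ∈ S := by
    intro g h1 h2 h3 b hb
    obtain ⟨b₁, hb₁, b₂, hb₂, rfl⟩ := Submodule.mem_sup.1 hb
    obtain ⟨b₃, hb₃, b₄, hb₄, rfl⟩ := Submodule.mem_sup.1 hb₁
    rw [lie_add, lie_add]
    exact add_mem (add_mem (h1 _ hb₃) (h2 _ hb₄)) (h3 _ hb₂)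
  -- By the Jacobi identity, normalizing `S` passes to brackets, so with this stronger claim only
  -- the generators need checking.
  have key : a ∈ S ∧ ∀ b ∈ S, ⁅a, b⁆ ∈ S := by
    induction ha using LieSubalgebra.lieSpan_induction with
    | mem a ha =>
      rcases ha with (⟨x, rfl⟩ | ⟨x, rfl⟩) | ⟨z, rfl⟩
      · have he : e x ∈ P := LieSubalgebra.subset_lieSpan ⟨x, rfl⟩
        refine ⟨hP he, ext _ (fun b hb => ?_) (fun b hb => ?_) fun b hb => ?_⟩
        · refine (le_sup_left : N.toSubmodule ⊔ T ≤ S)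
            (lie_opposite_mem (fun z a => r.lie_h_f_mem z) ?_ hb)
          rintro _ ⟨y, rfl⟩
          rw [r.ef]
          exact Submodule.subset_span ⟨_, rfl⟩
        · rw [← lie_skew]
          exact hP (neg_mem (span_h_lie_mem (fun z a => r.lie_h_e_mem z) hb he))
        · exact hP (LieSubalgebra.lie_mem _ he hb)
      · have hf : f x ∈ N := LieSubalgebra.subset_lieSpan ⟨x, rfl⟩
        refine ⟨hN hf, ext _ (fun b hb => ?_) (fun b hb => ?_) fun b hb => ?_⟩
        · exact hN (LieSubalgebra.lie_mem _ hf hb)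
        · rw [← lie_skew]
          exact hN (neg_mem (span_h_lie_mem (fun z a => r.lie_h_f_mem z) hb hf))
        · refine (sup_le hP hT : P.toSubmodule ⊔ T ≤ S)
            (lie_opposite_mem (fun z a => r.lie_h_e_mem z) ?_ hb)
          rintro _ ⟨y, rfl⟩
          rw [← lie_skew, r.ef]
          exact neg_mem (Submodule.subset_span ⟨_, rfl⟩)
      · refine ⟨hT (Submodule.subset_span ⟨z, rfl⟩), ext _ (fun b hb => hN (r.lie_h_f_mem z hb))
          (fun b hb => ?_) fun b hb => hP (r.lie_h_e_mem z hb)⟩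
        have : ⁅h z, b⁆ = 0 := by
          induction hb using Submodule.span_induction with
          | mem b hb => obtain ⟨z', rfl⟩ := hb; exact r.hh z z'
          | zero => simp
          | smul c b _ ih => rw [lie_smul, ih, smul_zero]
          | add b c _ _ ihb ihc => rw [lie_add, ihb, ihc, add_zero]
        rw [this]
        exact zero_mem _
    | zero => exact ⟨zero_mem _, fun b _ => by rw [zero_lie]; exact zero_mem _⟩
    | smul c a _ ih =>
      exact ⟨S.smul_mem c ih.1, fun b hb => by rw [smul_lie]; exact S.smul_mem c (ih.2 b hb)⟩
    | add a b _ _ iha ihb =>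
      exact ⟨add_mem iha.1 ihb.1, fun c hc => by
        rw [add_lie]; exact add_mem (iha.2 c hc) (ihb.2 c hc)⟩
    | lie a b _ _ iha ihb =>
      exact ⟨iha.2 b ihb.1, fun c hc => by
        rw [lie_lie]; exact sub_mem (iha.2 _ (ihb.2 c hc)) (ihb.2 _ (iha.2 c hc))⟩
  exact key.1

end TriData.Rels

/-- A Lie subalgebra generated by eigenvectors of `ad g` with eigenvalues in `k • ℕ₊` has no
component of eigenvalue zero. -/
lemma lieSpan_le_offEigen {L : Type*} [LieRing L] [LieAlgebra ℂ L] {s : Set L} (g : L)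
    (k : ℂ) (hk : k ≠ 0) (hs : ∀ a ∈ s, ⁅g, a⁆ = k • a) {a : L} (ha : a ∈ LieSubalgebra.lieSpan ℂ L s) :
    a ∈ offEigen (LieAlgebra.ad ℂ L g) 0 := by
  -- The shift `m + 1` keeps the eigenvalues away from zero. Brackets add them, whence the witness
  -- `m + m' + 1` below.
  have key : a ∈ Submodule.span ℂ {b : L | ∃ m : ℕ, ⁅g, b⁆ = (k * (m + 1)) • b} := by
    induction ha using LieSubalgebra.lieSpan_induction with
    | mem a ha => exact Submodule.subset_span ⟨0, by simpa using hs a ha⟩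
    | zero => simp
    | smul c a _ ih => exact Submodule.smul_mem _ c ih
    | add a b _ _ iha ihb => exact add_mem iha ihb
    | lie a b ha hb iha ihb =>
      clear ha hb
      induction iha using Submodule.span_induction with
      | zero => simp
      | smul c a _ ih => rw [smul_lie]; exact Submodule.smul_mem _ c ih
      | add a b _ _ iha ihb => rw [add_lie]; exact add_mem iha ihb
      | mem a ha =>
        obtain ⟨m, hm⟩ := ha
        induction ihb using Submodule.span_induction with
        | zero => simp
        | smul c a _ ih => rw [lie_smul]; exact Submodule.smul_mem _ c ih
        | add a b _ _ iha ihb => rw [lie_add]; exact add_mem iha ihb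
        | mem b hb =>
          obtain ⟨m', hm'⟩ := hb
          refine Submodule.subset_span ⟨m + m' + 1, ?_⟩
          rw [leibniz_lie, hm, hm', smul_lie, lie_smul, ← add_smul]
          congr 1
          push_cast
          ring
  clear ha
  induction key using Submodule.span_induction with
  | zero => exact zero_mem _
  | smul c a _ ih => exact Submodule.smul_mem _ c ih
  | add a b _ _ iha ihb => exact add_mem iha ihb
  | mem a ha =>
    obtain ⟨m, hm⟩ := ha
    exact mem_offEigen_of_eigen (μ := k * (m + 1)) hm (mul_ne_zero hk (Nat.cast_add_one_ne_zero m))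

/-! ### Highest weight modules in terms of generators -/

/-- Operators `E`, `F`, `H` satisfying the relations of `D`, with a vector `v` of highest weight `ψ`
which generates under the lowering operators. -/
structure TriData.HW (D : TriData X Z) {V : Type*} [AddCommGroup V] [Module ℂ V]
    (E F : X → Module.End ℂ V) (H : Z → Module.End ℂ V) (ψ : Z → ℂ) (v : V) : Prop where
  rels : D.Rels E F H
  raise : ∀ x, E x v = 0
  weight : ∀ z, H z v = ψ z • v
  gen : ∀ S : Submodule ℂ V, v ∈ S → (∀ x, ∀ w ∈ S, F x w ∈ S) → S = ⊤

/-- Highest weight modules in which all singular vectors are multiples of the (nonzero) highest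
weight vector; these are the irreducible ones. -/
structure TriData.SimpleHW (D : TriData X Z) {V : Type*} [AddCommGroup V] [Module ℂ V]
    (E F : X → Module.End ℂ V) (H : Z → Module.End ℂ V) (ψ : Z → ℂ) (v : V) : Prop
    extends D.HW E F H ψ v where
  ne_zero : v ≠ 0
  singular : ∀ w, (∀ x, E x w = 0) → ∃ a : ℂ, w = a • v

section Modules

variable {D : TriData X Z} {V : Type*} [AddCommGroup V] [Module ℂ V]
  {E F : X → Module.End ℂ V} {H : Z → Module.End ℂ V} {ψ : Z → ℂ} {v : V}

namespace TriData.Rels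

variable (r : D.Rels E F H)
include r

lemma H_E (z : Z) (x : X) (w : V) : H z (E x w) = E x (H z w) + E (D.act z x) w := by
  have := congrArg (fun T : Module.End ℂ V => T w) (r.he z x)
  simp only [LieRing.of_associative_ring_bracket, LinearMap.sub_apply, Module.End.mul_apply] at this
  rw [← this]; abel

lemma H_F (z : Z) (x : X) (w : V) : H z (F x w) = F x (H z w) - F (D.act z x) w := by
  have := congrArg (fun T : Module.End ℂ V => T w) (r.hf z x)
  simp only [LieRing.of_associative_ring_bracket, LinearMap.sub_apply, Module.End.mul_apply,
    LinearMap.neg_apply] at this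
  rw [sub_eq_add_neg, ← this]; abel

lemma E_F (x y : X) (w : V) : E x (F y w) = F y (E x w) + H (D.t x y) w := by
  have := congrArg (fun T : Module.End ℂ V => T w) (r.ef x y)
  simp only [LieRing.of_associative_ring_bracket, LinearMap.sub_apply, Module.End.mul_apply] at this
  rw [← this]; abel

end TriData.Rels

/-- The relations of `D` for operators, written out on vectors. -/
lemma TriData.rels_of_apply (hh : ∀ z z' w, H z (H z' w) = H z' (H z w))
    (he : ∀ z x w, H z (E x w) = E x (H z w) + E (D.act z x) w)
    (hf : ∀ z x w, H z (F x w) = F x (H z w) - F (D.act z x) w)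
    (ef : ∀ x y w, E x (F y w) = F y (E x w) + H (D.t x y) w) : D.Rels E F H where
  hh z z' := by
    ext w; simp [LieRing.of_associative_ring_bracket, hh z z' w]
  he z x := by
    ext w; simp [LieRing.of_associative_ring_bracket, he z x w]
  hf z x := by
    ext w; simp [LieRing.of_associative_ring_bracket, hf z x w]
  ef x y := by
    ext w; simp [LieRing.of_associative_ring_bracket, ef x y w]

/-- A cyclic vector of highest weight generates under the lowering operators. -/
lemma TriData.hw_of_cyclic (r : D.Rels E F H) (raise : ∀ x, E x v = 0)
    (weight : ∀ z, H z v = ψ z • v)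
    (cyc : ∀ S : Submodule ℂ V, v ∈ S → (∀ x, ∀ w ∈ S, F x w ∈ S) → (∀ x, ∀ w ∈ S, E x w ∈ S) →
      (∀ z, ∀ w ∈ S, H z w ∈ S) → S = ⊤) : D.HW E F H ψ v where
  rels := r
  raise := raise
  weight := weight
  gen S hv hF := by
    -- The smallest lowering-stable subspace containing `v` is stable under the other operators too:
    -- they can be commuted past each `F x` down to `v`. The diagonal ones come first, since
    -- commuting `E` with `F` produces them.
    let S₁ : Submodule ℂ V := sInf {S | v ∈ S ∧ ∀ x, ∀ w ∈ S, F x w ∈ S}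
    have hv₁ : v ∈ S₁ := by simp +contextual [S₁]
    have hF₁ : ∀ x, ∀ w ∈ S₁, F x w ∈ S₁ := fun x w hw => by
      simp only [S₁, Submodule.mem_sInf, Set.mem_ofPred_eq, and_imp] at hw ⊢
      exact fun S h1 h2 => h2 x w (hw S h1 h2)
    have ind : ∀ S : Submodule ℂ V, v ∈ S → (∀ x, ∀ w ∈ S, F x w ∈ S) → S₁ ≤ S :=
      fun S h1 h2 => sInf_le ⟨h1, h2⟩
    have hH₁ : ∀ z, ∀ w ∈ S₁, H z w ∈ S₁ := by
      have := ind (S₁ ⊓ ⨅ z, S₁.comap (H z)) ?_ ?_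
      · intro z w hw
        exact (Submodule.mem_iInf _).1 (this hw).2 z
      · refine ⟨hv₁, (Submodule.mem_iInf _).2 fun z => ?_⟩
        rw [Submodule.mem_comap, weight]
        exact S₁.smul_mem _ hv₁
      · rintro x w ⟨hw, hw'⟩
        refine ⟨hF₁ x w hw, (Submodule.mem_iInf _).2 fun z => ?_⟩
        rw [Submodule.mem_comap, r.H_F]
        exact sub_mem (hF₁ _ _ ((Submodule.mem_iInf _).1 hw' z)) (hF₁ _ _ hw)
    have hE₁ : ∀ x, ∀ w ∈ S₁, E x w ∈ S₁ := by
      have := ind (S₁ ⊓ ⨅ x, S₁.comap (E x)) ?_ ?_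
      · intro z w hw
        exact (Submodule.mem_iInf _).1 (this hw).2 z
      · refine ⟨hv₁, (Submodule.mem_iInf _).2 fun z => ?_⟩
        rw [Submodule.mem_comap, raise]
        exact zero_mem _
      · rintro x w ⟨hw, hw'⟩
        refine ⟨hF₁ x w hw, (Submodule.mem_iInf _).2 fun z => ?_⟩
        rw [Submodule.mem_comap, r.E_F]
        exact add_mem (hF₁ _ _ ((Submodule.mem_iInf _).1 hw' z)) (hH₁ _ _ hw)
    exact top_le_iff.1 ((cyc S₁ hv₁ hF₁ hE₁ hH₁).symm.le.trans (ind S hv hF))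

/-- The vectors killed by all products of `k` raising operators. -/
def raiseFiltration (E : X → Module.End ℂ V) : ℕ → Submodule ℂ V
  | 0 => ⊥
  | k + 1 => ⨅ x, (raiseFiltration E k).comap (E x)

/-! ### Weights and singular vectors in highest weight modules. -/

namespace TriData.HW

variable (M : D.HW E F H ψ v)
include M

/-- The module is spanned by eigenvectors of `H D.d` with eigenvalues `ψ D.d - m`, `m ≥ 0`, and
lowering increases `m` by one, so `m = 0` does not occur in the image. -/
lemma lower_mem_offEigen (x : X) (w : V) : F x w ∈ offEigen (H D.d) (ψ D.d) := by
  have key : w ∈ Submodule.span ℂ {w : V | ∃ m : ℕ, H D.d w = (ψ D.d - m) • w} := by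
    rw [M.gen (Submodule.span ℂ {w : V | ∃ m : ℕ, H D.d w = (ψ D.d - m) • w}) ?_ ?_]
    · trivial
    · exact Submodule.subset_span ⟨0, by simp [M.weight]⟩
    · intro x w hw
      induction hw using Submodule.span_induction with
      | zero => simp
      | smul c a _ ih => rw [map_smul]; exact Submodule.smul_mem _ c ih
      | add a b _ _ iha ihb => rw [map_add]; exact add_mem iha ihb
      | mem w hw =>
        obtain ⟨m, hm⟩ := hw
        refine Submodule.subset_span ⟨m + 1, ?_⟩
        rw [M.rels.H_F, D.act_d, hm, map_smul]
        push_cast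
        module
  induction key using Submodule.span_induction with
  | zero => simp
  | smul c a _ ih => rw [map_smul]; exact Submodule.smul_mem _ c ih
  | add a b _ _ iha ihb => rw [map_add]; exact add_mem iha ihb
  | mem w hw =>
    obtain ⟨m, hm⟩ := hw
    refine mem_offEigen_of_eigen (μ := ψ D.d - (m + 1)) ?_ ?_
    · rw [M.rels.H_F, D.act_d, hm, map_smul]
      module
    · rw [Ne, sub_eq_self]
      exact Nat.cast_add_one_ne_zero m

/-- The sum of the line of `v` and the vectors off the top eigenvalue contains `v` and all images of
lowering operators. This replaces the projection onto the highest weight space. -/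
lemma exists_eq_smul_add (w : V) : ∃ a : ℂ, ∃ u ∈ offEigen (H D.d) (ψ D.d), w = a • v + u := by
  have : w ∈ Submodule.span ℂ {v} ⊔ offEigen (H D.d) (ψ D.d) := by
    rw [M.gen (Submodule.span ℂ {v} ⊔ offEigen (H D.d) (ψ D.d))
      (Submodule.mem_sup_left (Submodule.mem_span_singleton_self v))
      fun x w _ => Submodule.mem_sup_right (M.lower_mem_offEigen x w)]
    trivial
  obtain ⟨y, hy, u, hu, rfl⟩ := Submodule.mem_sup.1 this
  obtain ⟨a, rfl⟩ := Submodule.mem_span_singleton.1 hy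
  exact ⟨a, u, hu, rfl⟩

/-- A nonzero subspace stable under the raising operators contains a nonzero singular vector. -/
lemma exists_singular {Q : Submodule ℂ V} (hQ : ∀ x, ∀ w ∈ Q, E x w ∈ Q) (hne : Q ≠ ⊥) :
    ∃ w ∈ Q, w ≠ 0 ∧ ∀ x, E x w = 0 := by
  -- Raising is locally nilpotent: `v` has level 1 and each lowering operator raises the level by at
  -- most one, so the filtration exhausts `V`. Raising a nonzero vector of `Q` as long as the result
  -- can be nonzero then ends at a singular vector.
  have hN₀ : raiseFiltration E 0 = ⊥ := rfl
  have hN : ∀ k w, w ∈ raiseFiltration E (k + 1) ↔ ∀ x, E x w ∈ raiseFiltration E k :=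
    fun k w => by simp [raiseFiltration]
  generalize raiseFiltration E = N at hN₀ hN
  have hH : ∀ k z, ∀ w ∈ N k, H z w ∈ N k := by
    intro k
    induction k with
    | zero => intro z w hw; rw [hN₀, Submodule.mem_bot] at hw; rw [hw, map_zero]; exact zero_mem _
    | succ k ih =>
      intro z w hw
      rw [hN] at hw ⊢
      intro x
      rw [← add_sub_cancel_right (E x (H z w)) (E (D.act z x) w), ← M.rels.H_E]
      exact sub_mem (ih _ _ (hw x)) (hw _)
  have hF : ∀ k x, ∀ w ∈ N k, F x w ∈ N (k + 1) := by
    intro k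
    induction k with
    | zero => intro z w hw; rw [hN₀, Submodule.mem_bot] at hw; rw [hw, map_zero]; exact zero_mem _
    | succ k ih =>
      intro z w hw
      rw [hN]
      intro x
      rw [M.rels.E_F]
      exact add_mem (ih _ _ ((hN _ _).1 hw x)) (hH _ _ _ hw)
  have hmono : Monotone N := by
    refine monotone_nat_of_le_succ fun k => ?_
    induction k with
    | zero => rw [hN₀]; exact bot_le
    | succ k ih => intro w hw; rw [hN] at hw ⊢; exact fun x => ih (hw x)
  have htop : (⨆ k, N k) = ⊤ := by
    refine M.gen _ ((Submodule.mem_iSup_of_directed N hmono.directed_le).2 ⟨1, ?_⟩) ?_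
    · rw [hN]; intro x; rw [M.raise]; exact zero_mem _
    · intro x w hw
      obtain ⟨k, hk⟩ := (Submodule.mem_iSup_of_directed N hmono.directed_le).1 hw
      exact (Submodule.mem_iSup_of_directed N hmono.directed_le).2 ⟨k + 1, hF k x w hk⟩
  have main : ∀ k, ∀ w ∈ Q, w ≠ 0 → w ∈ N k → ∃ w ∈ Q, w ≠ 0 ∧ ∀ x, E x w = 0 := by
    intro k
    induction k with
    | zero => intro w _ hw h; exact absurd ((Submodule.mem_bot ℂ).1 (hN₀ ▸ h)) hw
    | succ k ih =>
      intro w hwQ hw hk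
      by_cases hs : ∀ x, E x w = 0
      · exact ⟨w, hwQ, hw, hs⟩
      · push Not at hs
        obtain ⟨x, hx⟩ := hs
        exact ih _ (hQ x w hwQ) hx ((hN _ _).1 hk x)
  obtain ⟨w, hwQ, hw⟩ := Q.ne_bot_iff.1 hne
  have hwt : w ∈ ⨆ k, N k := htop ▸ Submodule.mem_top
  obtain ⟨k, hk⟩ := (Submodule.mem_iSup_of_directed N hmono.directed_le).1 hwt
  exact main k w hwQ hw hk

end TriData.HW

/-! ### Irreducible highest weight modules. -/

namespace TriData.SimpleHW

variable (M : D.SimpleHW E F H ψ v)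
include M

lemma mem_of_raise_stable {Q : Submodule ℂ V} (hQ : ∀ x, ∀ w ∈ Q, E x w ∈ Q) (hne : Q ≠ ⊥) :
    v ∈ Q := by
  obtain ⟨w, hwQ, hw, hs⟩ := M.exists_singular hQ hne
  obtain ⟨a, rfl⟩ := M.singular w hs
  have ha : a ≠ 0 := fun h => hw (by rw [h, zero_smul])
  exact (Q.smul_mem_iff ha).1 hwQ

lemma notMem_offEigen : v ∉ offEigen (H D.d) (ψ D.d) :=
  fun h => M.ne_zero (eq_zero_of_mem_offEigen (M.weight _) h)

/-- If nonzero, `Q` would contain `v`, an eigenvector for the excluded eigenvalue. This is the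
standard way below of showing that a subspace vanishes, without first proving it a submodule. -/
lemma eq_bot_of_le_offEigen {Q : Submodule ℂ V} (hQ : ∀ x, ∀ w ∈ Q, E x w ∈ Q)
    (hle : Q ≤ offEigen (H D.d) (ψ D.d)) : Q = ⊥ := by
  by_contra hne
  exact M.notMem_offEigen (hle (M.mem_of_raise_stable hQ hne))

/-- If `S` is a set of indices stable under the diagonal generators, and the highest weight vanishes
on diagonal generators arising from `S`, then the generators with index in `S` act by zero. -/
lemma eq_zero_of_mem {S : Set X} {Y : Set Z} (hS : ∀ z, ∀ x ∈ S, D.act z x ∈ S)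
    (hY : ∀ z ∈ Y, ∀ x, D.act z x ∈ S) (hψ : ∀ z ∈ Y, ψ z = 0)
    (ht : ∀ x, ∀ y ∈ S, D.t x y ∈ Y) (ht' : ∀ x ∈ S, ∀ y, D.t x y ∈ Y) :
    ∀ x ∈ S, E x = 0 ∧ F x = 0 := by
  -- The lowering-stable subspace generated by all `F x V` with `x ∈ S`. It turns out to be
  -- raising-stable, hence zero.
  let Q : Submodule ℂ V :=
    sInf {Q | (∀ x ∈ S, ∀ w, F x w ∈ Q) ∧ ∀ x, ∀ w ∈ Q, F x w ∈ Q}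
  have hFS : ∀ x ∈ S, ∀ w, F x w ∈ Q := by
    intro x hx w
    simp only [Q, Submodule.mem_sInf, Set.mem_ofPred_eq, and_imp]
    exact fun Q h _ => h x hx w
  have hF : ∀ x, ∀ w ∈ Q, F x w ∈ Q := fun x w hw => by
    simp only [Q, Submodule.mem_sInf, Set.mem_ofPred_eq, and_imp] at hw ⊢
    exact fun Q h1 h2 => h2 x w (hw Q h1 h2)
  have ind : ∀ T : Submodule ℂ V, (∀ x ∈ S, ∀ w, F x w ∈ T) → (∀ x, ∀ w ∈ T, F x w ∈ T) → Q ≤ T :=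
    fun T h1 h2 => sInf_le ⟨h1, h2⟩
  have hH : ∀ z, ∀ w ∈ Q, H z w ∈ Q := by
    have := ind (Q ⊓ ⨅ z, Q.comap (H z)) ?_ ?_
    · intro z w hw
      exact (Submodule.mem_iInf _).1 (this hw).2 z
    · refine fun x hx w => ⟨hFS x hx w, (Submodule.mem_iInf _).2 fun z => ?_⟩
      rw [Submodule.mem_comap, M.rels.H_F]
      exact sub_mem (hFS _ hx _) (hFS _ (hS z x hx) _)
    · rintro x w ⟨hw, hw'⟩
      refine ⟨hF x w hw, (Submodule.mem_iInf _).2 fun z => ?_⟩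
      rw [Submodule.mem_comap, M.rels.H_F]
      exact sub_mem (hF _ _ ((Submodule.mem_iInf _).1 hw' z)) (hF _ _ hw)
  -- Such an `H z` kills `v`, and its commutator with any `F x` is an `F` with index in `S`; so it
  -- maps all of `V` into `Q`.
  have hHY : ∀ z ∈ Y, ∀ w, H z w ∈ Q := by
    intro z hz w
    have : (Q.comap (H z)) = ⊤ := by
      refine M.gen _ ?_ fun x w hw => ?_
      · rw [Submodule.mem_comap, M.weight, hψ z hz, zero_smul]
        exact zero_mem _
      · rw [Submodule.mem_comap] at hw ⊢
        rw [M.rels.H_F]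
        exact sub_mem (hF _ _ hw) (hFS _ (hY z hz x) _)
    exact this.symm.le (Submodule.mem_top (x := w))
  have hE : ∀ x, ∀ w ∈ Q, E x w ∈ Q := by
    have := ind (Q ⊓ ⨅ x, Q.comap (E x)) ?_ ?_
    · intro z w hw
      exact (Submodule.mem_iInf _).1 (this hw).2 z
    · refine fun x hx w => ⟨hFS x hx w, (Submodule.mem_iInf _).2 fun z => ?_⟩
      rw [Submodule.mem_comap, M.rels.E_F]
      exact add_mem (hFS _ hx _) (hHY _ (ht _ _ hx) _)
    · rintro x w ⟨hw, hw'⟩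
      refine ⟨hF x w hw, (Submodule.mem_iInf _).2 fun z => ?_⟩
      rw [Submodule.mem_comap, M.rels.E_F]
      exact add_mem (hF _ _ ((Submodule.mem_iInf _).1 hw' z)) (hH _ _ hw)
  have hQ : Q = ⊥ := M.eq_bot_of_le_offEigen hE
    (ind _ (fun x _ w => M.lower_mem_offEigen x w) fun x w _ => M.lower_mem_offEigen x w)
  intro x hx
  constructor
  -- Now that `Q = 0`, the operator `E x` commutes with every `F y`, and it kills `v`.
  · have : LinearMap.ker (E x) = ⊤ := by
      refine M.gen _ (M.raise x) fun y w hw => ?_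
      rw [LinearMap.mem_ker] at hw ⊢
      have h0 : H (D.t x y) w ∈ Q := hHY _ (ht' x hx y) w
      rw [hQ, Submodule.mem_bot] at h0
      rw [M.rels.E_F, hw, map_zero, h0, add_zero]
    exact LinearMap.ker_eq_top.1 this
  · ext w
    have h0 := hFS x hx w
    rw [hQ, Submodule.mem_bot] at h0
    simpa using h0

end TriData.SimpleHW

/-- Transport of structure. -/
lemma TriData.SimpleHW.of_equiv (M : D.SimpleHW E F H ψ v) {V' : Type*} [AddCommGroup V']
    [Module ℂ V'] {E' F' : X → Module.End ℂ V'} {H' : Z → Module.End ℂ V'} (r : D.Rels E' F' H')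
    (θ : V ≃ₗ[ℂ] V') (hE : ∀ x w, θ (E x w) = E' x (θ w)) (hF : ∀ x w, θ (F x w) = F' x (θ w))
    (hH : ∀ z w, θ (H z w) = H' z (θ w)) : D.SimpleHW E' F' H' ψ (θ v) where
  rels := r
  raise x := by rw [← hE, M.raise, map_zero]
  weight z := by rw [← hH, M.weight, map_smul]
  gen S hv hS := by
    have := M.gen (S.comap θ.toLinearMap) hv fun x w hw => by
      rw [Submodule.mem_comap, LinearEquiv.coe_coe, hF]
      exact hS x _ hw
    rw [eq_top_iff]
    intro w _
    have hw : θ.symm w ∈ S.comap θ.toLinearMap := this ▸ Submodule.mem_top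
    simpa using hw
  ne_zero h := M.ne_zero (by simpa using h)
  singular w hw := by
    obtain ⟨a, ha⟩ := M.singular (θ.symm w) fun x => θ.injective (by simp [hE, hw])
    exact ⟨a, by rw [← map_smul, ← ha, LinearEquiv.apply_symm_apply]⟩

/-- Contract the first factor with a functional that does not vanish on `a`. -/
lemma eq_zero_of_tmul_eq_zero {V₁ V₂ : Type*} [AddCommGroup V₁] [Module ℂ V₁] [AddCommGroup V₂]
    [Module ℂ V₂] {a : V₁} {b : V₂} (ha : a ≠ 0) (h : a ⊗ₜ[ℂ] b = 0) : b = 0 := by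
  have : ¬ ∀ φ : Module.Dual ℂ V₁, φ a = 0 := fun h =>
    ha ((Module.forall_dual_apply_eq_zero_iff ℂ a).1 h)
  push Not at this
  obtain ⟨φ, hφ⟩ := this
  have := congrArg (fun w => TensorProduct.lid ℂ V₂ (φ.rTensor V₂ w)) h
  simpa [hφ] using this

/-- Tensor products of irreducible highest weight modules on which complementary sets of generators
act by zero are irreducible highest weight modules. -/
lemma TriData.SimpleHW.tensor {V₁ V₂ : Type*} [AddCommGroup V₁] [Module ℂ V₁] [AddCommGroup V₂]
    [Module ℂ V₂] {E₁ F₁ : X → Module.End ℂ V₁} {H₁ : Z → Module.End ℂ V₁} {ψ₁ : Z → ℂ} {v₁ : V₁}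
    {E₂ F₂ : X → Module.End ℂ V₂} {H₂ : Z → Module.End ℂ V₂} {ψ₂ : Z → ℂ} {v₂ : V₂}
    (M₁ : D.SimpleHW E₁ F₁ H₁ ψ₁ v₁) (M₂ : D.SimpleHW E₂ F₂ H₂ ψ₂ v₂)
    {E F : X → Module.End ℂ (V₁ ⊗[ℂ] V₂)} {H : Z → Module.End ℂ (V₁ ⊗[ℂ] V₂)}
    (r : D.Rels E F H)
    (hE : ∀ x, E x = (E₁ x).rTensor V₂ + (E₂ x).lTensor V₁)
    (hF : ∀ x, F x = (F₁ x).rTensor V₂ + (F₂ x).lTensor V₁)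
    (hH : ∀ z, H z = (H₁ z).rTensor V₂ + (H₂ z).lTensor V₁)
    (h₁ : ∀ x, ∃ y, E₁ y = E₁ x ∧ F₁ y = F₁ x ∧ E₂ y = 0 ∧ F₂ y = 0)
    (h₂ : ∀ x, ∃ y, E₂ y = E₂ x ∧ F₂ y = F₂ x ∧ E₁ y = 0 ∧ F₁ y = 0) :
    D.SimpleHW E F H (fun z => ψ₁ z + ψ₂ z) (v₁ ⊗ₜ v₂) where
  rels := r
  raise x := by simp [hE, M₁.raise, M₂.raise]
  weight z := by
    simp [hH, M₁.weight, M₂.weight, TensorProduct.smul_tmul', TensorProduct.tmul_smul, add_smul]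
  gen S hv hS := by
    -- The index `y` acts as `x` on the first factor and by zero on the second, so `F y` isolates
    -- the action on `V₁`.
    have hS₁ : ∀ x, ∀ w ∈ S, (F₁ x).rTensor V₂ w ∈ S := by
      intro x w hw
      obtain ⟨y, -, h1, -, h2⟩ := h₁ x
      simpa [hF, h1, h2] using hS y w hw
    have hS₂ : ∀ x, ∀ w ∈ S, (F₂ x).lTensor V₁ w ∈ S := by
      intro x w hw
      obtain ⟨y, -, h1, -, h2⟩ := h₂ x
      simpa [hF, h1, h2] using hS y w hw
    have hA : ∀ u₁, u₁ ⊗ₜ[ℂ] v₂ ∈ S := by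
      have := M₁.gen (S.comap ((TensorProduct.mk ℂ V₁ V₂).flip v₂)) (by simpa using hv)
        fun x w hw => by
          have := hS₁ x _ (show w ⊗ₜ[ℂ] v₂ ∈ S by simpa using hw)
          simpa using this
      intro u
      have hu : u ∈ S.comap ((TensorProduct.mk ℂ V₁ V₂).flip v₂) := this ▸ Submodule.mem_top
      simpa using hu
    have hB : ∀ u₁ u₂, u₁ ⊗ₜ[ℂ] u₂ ∈ S := by
      intro u₁ u
      have := M₂.gen (S.comap (TensorProduct.mk ℂ V₁ V₂ u₁)) (by simpa using hA u₁)
        fun x w hw => by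
          have := hS₂ x _ (show u₁ ⊗ₜ[ℂ] w ∈ S by simpa using hw)
          simpa using this
      have hu : u ∈ S.comap (TensorProduct.mk ℂ V₁ V₂ u₁) := this ▸ Submodule.mem_top
      simpa using hu
    rw [eq_top_iff, ← TensorProduct.span_tmul_eq_top, Submodule.span_le]
    rintro _ ⟨u₁, u₂, rfl⟩
    exact hB u₁ u₂
  ne_zero := by
    intro h0
    exact M₂.ne_zero (eq_zero_of_tmul_eq_zero M₁.ne_zero h0)
  singular w hw := by
    have hw₁ : ∀ x, (E₁ x).rTensor V₂ w = 0 := by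
      intro x
      obtain ⟨y, h1, -, h2, -⟩ := h₁ x
      simpa [hE, h1, h2] using hw y
    have hw₂ : ∀ x, (E₂ x).lTensor V₁ w = 0 := by
      intro x
      obtain ⟨y, h1, -, h2, -⟩ := h₂ x
      simpa [hE, h1, h2] using hw y
    let b := Module.Free.chooseBasis ℂ V₂
    -- Expand `w` along a basis of `V₂`: as `E₁ x` kills `w` through the first factor, each
    -- coefficient is singular in `V₁`, hence a multiple of `v₁`.
    obtain ⟨u, rfl⟩ : ∃ u, w = v₁ ⊗ₜ[ℂ] u := by
      obtain ⟨c, rfl⟩ := TensorProduct.eq_repr_basis_right b w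
      have : ∀ k, ∃ a : ℂ, c k = a • v₁ := fun k => M₁.singular _ fun x => by
        have h0 := TensorProduct.sum_tmul_basis_right_eq_zero b (c.mapRange (E₁ x) (map_zero _)) (by
          rw [Finsupp.sum_mapRange_index (by simp)]
          simpa [Finsupp.sum] using hw₁ x)
        simpa using congrArg (fun g => g k) h0
      choose a ha using this
      refine ⟨c.sum fun k _ => a k • b k, ?_⟩
      simp only [Finsupp.sum, TensorProduct.tmul_sum, TensorProduct.tmul_smul]
      refine Finset.sum_congr rfl fun k _ => ?_
      rw [ha k, TensorProduct.smul_tmul']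
    have hu : ∀ x, E₂ x u = 0 := fun x =>
      eq_zero_of_tmul_eq_zero M₁.ne_zero (by simpa using hw₂ x)
    obtain ⟨a, rfl⟩ := M₂.singular u hu
    exact ⟨a, by rw [TensorProduct.tmul_smul]⟩

end Modules

variable {X Z : Type*}

/-! ### Highest weight modules over the free algebra on the lowering operators -/

section Free

lemma freeAlgebra_eq_top {S : Submodule ℂ (FreeAlgebra ℂ X)} (h1 : 1 ∈ S)
    (hx : ∀ x, ∀ w ∈ S, FreeAlgebra.ι ℂ x * w ∈ S) : S = ⊤ := by
  have key : ∀ a : FreeAlgebra ℂ X, ∀ w ∈ S, a * w ∈ S := by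
    intro a
    induction a using FreeAlgebra.induction with
    | grade0 c =>
      intro w hw
      rw [← Algebra.smul_def]
      exact S.smul_mem c hw
    | grade1 x => exact hx x
    | mul a b iha ihb =>
      intro w hw
      rw [mul_assoc]
      exact iha _ (ihb _ hw)
    | add a b iha ihb =>
      intro w hw
      rw [add_mul]
      exact add_mem (iha _ hw) (ihb _ hw)
  rw [eq_top_iff]
  intro a _
  simpa using key a 1 h1

lemma freeAlgebra_linearMap_eq {V : Type*} [AddCommGroup V] [Module ℂ V]
    (φ φ' : FreeAlgebra ℂ X →ₗ[ℂ] V) (h1 : φ 1 = φ' 1)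
    (hx : ∀ x w, φ w = φ' w → φ (FreeAlgebra.ι ℂ x * w) = φ' (FreeAlgebra.ι ℂ x * w))
    (w : FreeAlgebra ℂ X) : φ w = φ' w := by
  have : w ∈ LinearMap.eqLocus φ φ' := by
    rw [freeAlgebra_eq_top (S := LinearMap.eqLocus φ φ') h1 hx]
    trivial
  exact this

/-- The linear map `D` on the free algebra with `D 1 = a` and `D (x w) = x D w + c x w`. -/
def freeExtend (c : X → Module.End ℂ (FreeAlgebra ℂ X)) (a : FreeAlgebra ℂ X) :
    Module.End ℂ (FreeAlgebra ℂ X) :=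
  -- The recursion needs `w` as well as `D w`, so it runs on pairs: the letter `x` sends `(w, u)` to
  -- `(x w, x u + c x w)`, starting from `(1, a)`.
  LinearMap.snd ℂ _ _ ∘ₗ LinearMap.applyₗ (R := ℂ) (1, a) ∘ₗ
    (FreeAlgebra.lift ℂ fun x : X =>
      ((LinearMap.mulLeft ℂ (FreeAlgebra.ι ℂ x) ∘ₗ LinearMap.fst ℂ _ _).prod
        (LinearMap.mulLeft ℂ (FreeAlgebra.ι ℂ x) ∘ₗ LinearMap.snd ℂ _ _ +
          c x ∘ₗ LinearMap.fst ℂ _ _) :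
        Module.End ℂ (FreeAlgebra ℂ X × FreeAlgebra ℂ X))).toLinearMap

variable (c : X → Module.End ℂ (FreeAlgebra ℂ X)) (a : FreeAlgebra ℂ X)

lemma freeExtend_one : freeExtend c a 1 = a := by
  simp [freeExtend]

lemma freeExtend_mul (x : X) (w : FreeAlgebra ℂ X) :
    freeExtend c a (FreeAlgebra.ι ℂ x * w) = FreeAlgebra.ι ℂ x * freeExtend c a w + c x w := by
  -- The first component of the pair is the word itself.
  have h := freeAlgebra_linearMap_eq (LinearMap.fst ℂ _ _ ∘ₗ LinearMap.applyₗ (R := ℂ) (1, a) ∘ₗ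
    (FreeAlgebra.lift ℂ fun x : X =>
      ((LinearMap.mulLeft ℂ (FreeAlgebra.ι ℂ x) ∘ₗ LinearMap.fst ℂ _ _).prod
        (LinearMap.mulLeft ℂ (FreeAlgebra.ι ℂ x) ∘ₗ LinearMap.snd ℂ _ _ +
          c x ∘ₗ LinearMap.fst ℂ _ _) :
        Module.End ℂ (FreeAlgebra ℂ X × FreeAlgebra ℂ X))).toLinearMap) LinearMap.id (by simp)
    (fun x w h => by simpa using h) w
  simp only [LinearMap.comp_apply, LinearMap.applyₗ_apply_apply, AlgHom.toLinearMap_apply,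
    LinearMap.id_apply] at h
  simp only [freeExtend, LinearMap.comp_apply, LinearMap.applyₗ_apply_apply,
    AlgHom.toLinearMap_apply, map_mul, FreeAlgebra.lift_ι_apply, Module.End.mul_apply, LinearMap.prod_apply,
    Function.prod_apply, LinearMap.add_apply, LinearMap.snd_apply, LinearMap.mulLeft_apply]
  exact congrArg (_ + c x ·) h

variable (D : TriData X Z) (ψ : Z → ℂ)

/-- The lowering operators on the free algebra. -/
def freeF (x : X) : Module.End ℂ (FreeAlgebra ℂ X) := LinearMap.mulLeft ℂ (FreeAlgebra.ι ℂ x)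

/-- The diagonal operators on the free algebra. -/
def freeH (z : Z) : Module.End ℂ (FreeAlgebra ℂ X) :=
  freeExtend (fun x => -freeF (D.act z x)) (ψ z • 1)

/-- The raising operators on the free algebra. -/
def freeE (x : X) : Module.End ℂ (FreeAlgebra ℂ X) :=
  freeExtend (fun y => freeH D ψ (D.t x y)) 0

lemma freeH_one (z : Z) : freeH D ψ z 1 = ψ z • 1 := freeExtend_one _ _

lemma freeE_one (x : X) : freeE D ψ x 1 = 0 := freeExtend_one _ _

lemma freeH_freeF (z : Z) (x : X) (w : FreeAlgebra ℂ X) :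
    freeH D ψ z (freeF x w) = freeF x (freeH D ψ z w) - freeF (D.act z x) w := by
  rw [sub_eq_add_neg]
  exact freeExtend_mul _ _ _ _

lemma freeE_freeF (x y : X) (w : FreeAlgebra ℂ X) :
    freeE D ψ x (freeF y w) = freeF y (freeE D ψ x w) + freeH D ψ (D.t x y) w :=
  freeExtend_mul _ _ _ _

lemma freeH_freeH (z z' : Z) (w : FreeAlgebra ℂ X) :
    freeH D ψ z (freeH D ψ z' w) = freeH D ψ z' (freeH D ψ z w) := by
  refine freeAlgebra_linearMap_eq (freeH D ψ z ∘ₗ freeH D ψ z') (freeH D ψ z' ∘ₗ freeH D ψ z)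
    ?_ (fun x w ih => ?_) w
  · simp [freeH_one, smul_smul, mul_comm]
  · change freeH D ψ z (freeH D ψ z' (freeF x w)) = freeH D ψ z' (freeH D ψ z (freeF x w))
    simp only [LinearMap.comp_apply] at ih
    simp only [freeH_freeF, map_sub, ih, D.act_comm z z']
    abel

/-- Induction on words: past a lowering operator `y`, the two sides differ by the diagonal operators
of index `t (act z x) y` and `t x (act z y)`, which cancel by `t_act`. -/
lemma freeH_freeE (z : Z) (x : X) (w : FreeAlgebra ℂ X) :
    freeH D ψ z (freeE D ψ x w) = freeE D ψ x (freeH D ψ z w) + freeE D ψ (D.act z x) w := by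
  refine freeAlgebra_linearMap_eq (freeH D ψ z ∘ₗ freeE D ψ x)
    (freeE D ψ x ∘ₗ freeH D ψ z + freeE D ψ (D.act z x)) ?_ (fun y w ih => ?_) w
  · simp [freeH_one, freeE_one]
  · change freeH D ψ z (freeE D ψ x (freeF y w)) =
      freeE D ψ x (freeH D ψ z (freeF y w)) + freeE D ψ (D.act z x) (freeF y w)
    simp only [LinearMap.comp_apply, LinearMap.add_apply] at ih
    simp only [freeH_freeF, freeE_freeF, map_sub, map_add, ih, D.t_act,
      freeH_freeH D ψ z (D.t x y)]
    abel

/-- The coefficient of `1`. -/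
def freeCounit : FreeAlgebra ℂ X →ₗ[ℂ] ℂ := (FreeAlgebra.algebraMapInv (R := ℂ)).toLinearMap

lemma freeCounit_one : freeCounit (1 : FreeAlgebra ℂ X) = 1 := by simp [freeCounit]

lemma freeCounit_freeF (x : X) (w : FreeAlgebra ℂ X) : freeCounit (freeF x w) = 0 := by
  simp [freeCounit, freeF, FreeAlgebra.algebraMapInv]

lemma freeCounit_freeH (z : Z) (w : FreeAlgebra ℂ X) :
    freeCounit (freeH D ψ z w) = ψ z * freeCounit w := by
  refine freeAlgebra_linearMap_eq (freeCounit ∘ₗ freeH D ψ z) (ψ z • freeCounit) ?_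
    (fun y w ih => ?_) w
  · simp [freeH_one, freeCounit_one]
  · change freeCounit (freeH D ψ z (freeF y w)) = ψ z * freeCounit (freeF y w)
    simp [freeH_freeF, freeCounit_freeF]

/-- The largest subspace without constant terms that is stable under the raising operators. -/
def freeRadical : Submodule ℂ (FreeAlgebra ℂ X) :=
  sSup {P | (∀ x, ∀ w ∈ P, freeE D ψ x w ∈ P) ∧ P ≤ LinearMap.ker freeCounit}

lemma le_freeRadical {P : Submodule ℂ (FreeAlgebra ℂ X)} (h : ∀ x, ∀ w ∈ P, freeE D ψ x w ∈ P)
    (h' : ∀ w ∈ P, freeCounit w = 0) : P ≤ freeRadical D ψ :=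
  le_sSup ⟨h, h'⟩

lemma freeE_mem_freeRadical (x : X) {w : FreeAlgebra ℂ X} (hw : w ∈ freeRadical D ψ) :
    freeE D ψ x w ∈ freeRadical D ψ := by
  have : freeRadical D ψ ≤ (freeRadical D ψ).comap (freeE D ψ x) :=
    sSup_le fun P hP w hw => (le_sSup hP : P ≤ freeRadical D ψ) (hP.1 x w hw)
  exact this hw

lemma freeCounit_eq_zero {w : FreeAlgebra ℂ X} (hw : w ∈ freeRadical D ψ) : freeCounit w = 0 :=
  (sSup_le fun _ hP => hP.2 : freeRadical D ψ ≤ LinearMap.ker freeCounit) hw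

/-- Adjoining the images under the diagonal operators keeps the radical raising-stable and free of
constant terms, so by maximality nothing new is added. -/
lemma freeH_mem_freeRadical (z : Z) {w : FreeAlgebra ℂ X} (hw : w ∈ freeRadical D ψ) :
    freeH D ψ z w ∈ freeRadical D ψ := by
  have : freeRadical D ψ ⊔ ⨆ z, (freeRadical D ψ).map (freeH D ψ z) ≤ freeRadical D ψ := by
    set Q := freeRadical D ψ ⊔ ⨆ z, (freeRadical D ψ).map (freeH D ψ z)
    have hQ : freeRadical D ψ ≤ Q := le_sup_left
    have hQH : ∀ z, (freeRadical D ψ).map (freeH D ψ z) ≤ Q := fun z =>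
      (le_iSup (fun z => (freeRadical D ψ).map (freeH D ψ z)) z).trans le_sup_right
    refine le_freeRadical D ψ (fun x => ?_) ?_
    · change Q ≤ Q.comap (freeE D ψ x)
      refine sup_le (fun w hw => hQ (freeE_mem_freeRadical D ψ x hw)) (iSup_le fun z => ?_)
      rintro _ ⟨w, hw, rfl⟩
      rw [Submodule.mem_comap,
        ← add_sub_cancel_right (freeE D ψ x (freeH D ψ z w)) (freeE D ψ (D.act z x) w),
        ← freeH_freeE]
      exact sub_mem (hQH z ⟨_, freeE_mem_freeRadical D ψ x hw, rfl⟩)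
        (hQ (freeE_mem_freeRadical D ψ _ hw))
    · change Q ≤ LinearMap.ker freeCounit
      refine sup_le (fun w hw => freeCounit_eq_zero D ψ hw) (iSup_le fun z => ?_)
      rintro _ ⟨w, hw, rfl⟩
      rw [LinearMap.mem_ker, freeCounit_freeH, freeCounit_eq_zero D ψ hw, mul_zero]
  exact this (Submodule.mem_sup_right
    ((le_iSup (fun z => (freeRadical D ψ).map (freeH D ψ z)) z) ⟨w, hw, rfl⟩))

/-- The same maximality argument; the commutator of raising and lowering operators is diagonal, so
stability under those is used. -/
lemma freeF_mem_freeRadical (x : X) {w : FreeAlgebra ℂ X} (hw : w ∈ freeRadical D ψ) :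
    freeF x w ∈ freeRadical D ψ := by
  have : freeRadical D ψ ⊔ ⨆ z, (freeRadical D ψ).map (freeF z) ≤ freeRadical D ψ := by
    set Q := freeRadical D ψ ⊔ ⨆ z, (freeRadical D ψ).map (freeF z)
    have hQ : freeRadical D ψ ≤ Q := le_sup_left
    have hQF : ∀ z, (freeRadical D ψ).map (freeF z) ≤ Q := fun z =>
      (le_iSup (fun z => (freeRadical D ψ).map (freeF z)) z).trans le_sup_right
    refine le_freeRadical D ψ (fun x => ?_) ?_
    · change Q ≤ Q.comap (freeE D ψ x)
      refine sup_le (fun w hw => hQ (freeE_mem_freeRadical D ψ x hw)) (iSup_le fun z => ?_)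
      rintro _ ⟨w, hw, rfl⟩
      rw [Submodule.mem_comap, freeE_freeF]
      exact add_mem (hQF z ⟨_, freeE_mem_freeRadical D ψ x hw, rfl⟩)
        (hQ (freeH_mem_freeRadical D ψ _ hw))
    · change Q ≤ LinearMap.ker freeCounit
      refine sup_le (fun w hw => freeCounit_eq_zero D ψ hw) (iSup_le fun z => ?_)
      rintro _ ⟨w, hw, rfl⟩
      rw [LinearMap.mem_ker, freeCounit_freeF]
  exact this (Submodule.mem_sup_right
    ((le_iSup (fun z => (freeRadical D ψ).map (freeF z)) x) ⟨w, hw, rfl⟩))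

/-- The irreducible highest weight module as a quotient of the free algebra. -/
lemma free_simpleHW : D.SimpleHW
    (fun x => (freeRadical D ψ).mapQ (freeRadical D ψ) (freeE D ψ x)
      fun _ => freeE_mem_freeRadical D ψ x)
    (fun x => (freeRadical D ψ).mapQ (freeRadical D ψ) (freeF x)
      fun _ => freeF_mem_freeRadical D ψ x)
    (fun z => (freeRadical D ψ).mapQ (freeRadical D ψ) (freeH D ψ z)
      fun _ => freeH_mem_freeRadical D ψ z)
    ψ ((freeRadical D ψ).mkQ 1) where
  rels := by
    refine TriData.rels_of_apply ?_ ?_ ?_ ?_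
    · intro z z' w
      obtain ⟨w, rfl⟩ := (freeRadical D ψ).mkQ_surjective w
      simp [freeH_freeH D ψ z z']
    · intro z x w
      obtain ⟨w, rfl⟩ := (freeRadical D ψ).mkQ_surjective w
      simp [freeH_freeE D ψ z x]
    · intro z x w
      obtain ⟨w, rfl⟩ := (freeRadical D ψ).mkQ_surjective w
      simp [freeH_freeF D ψ z x]
    · intro x y w
      obtain ⟨w, rfl⟩ := (freeRadical D ψ).mkQ_surjective w
      simp [freeE_freeF D ψ x y]
  raise x := by simp [freeE_one]
  weight z := by simp [freeH_one]
  gen S hv hS := by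
    have : S.comap (freeRadical D ψ).mkQ = ⊤ := freeAlgebra_eq_top hv fun x w hw => hS x _ hw
    rw [eq_top_iff]
    intro w _
    obtain ⟨w, rfl⟩ := (freeRadical D ψ).mkQ_surjective w
    exact this.symm.le (Submodule.mem_top (x := w))
  ne_zero h := by
    have := freeCounit_eq_zero D ψ ((Submodule.Quotient.mk_eq_zero _).1 h)
    rw [freeCounit_one] at this
    exact one_ne_zero this
  singular w hw := by
    obtain ⟨w, rfl⟩ := (freeRadical D ψ).mkQ_surjective w
    refine ⟨freeCounit w, ?_⟩
    have hw' : ∀ x, freeE D ψ x w ∈ freeRadical D ψ := fun x =>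
      (Submodule.Quotient.mk_eq_zero _).1 (hw x)
    -- Raising sends `w` into the radical and kills `1`, so `w` minus its constant term can be
    -- adjoined to the radical; maximality puts it inside.
    have : freeRadical D ψ ⊔ Submodule.span ℂ {w - freeCounit w • 1} ≤ freeRadical D ψ := by
      set Q := freeRadical D ψ ⊔ Submodule.span ℂ {w - freeCounit w • 1}
      have hQ : freeRadical D ψ ≤ Q := le_sup_left
      refine le_freeRadical D ψ (fun x => ?_) ?_
      · change Q ≤ Q.comap (freeE D ψ x)
        refine sup_le (fun w hw => hQ (freeE_mem_freeRadical D ψ x hw)) ?_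
        rw [Submodule.span_singleton_le_iff_mem, Submodule.mem_comap, map_sub, map_smul, freeE_one,
          smul_zero, sub_zero]
        exact hQ (hw' x)
      · change Q ≤ LinearMap.ker freeCounit
        refine sup_le (fun w hw => freeCounit_eq_zero D ψ hw) ?_
        rw [Submodule.span_singleton_le_iff_mem, LinearMap.mem_ker]
        simp [freeCounit_one]
    rw [← sub_eq_zero, ← map_smul, ← map_sub]
    exact (Submodule.Quotient.mk_eq_zero _).2
      (this (Submodule.mem_sup_right (Submodule.mem_span_singleton_self _)))

end Free

/-! ### Extending an irreducible highest weight module to the whole Lie algebra -/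

section Graph

variable {D : TriData X Z} {V : Type*} [AddCommGroup V] [Module ℂ V]
  {E F : X → Module.End ℂ V} {H : Z → Module.End ℂ V} {ψ : Z → ℂ} {v : V}
  {L : Type*} [LieRing L] [LieAlgebra ℂ L] {e f : X → L} {h : Z → L}

/-- The subalgebra generated by the graph of the action on generators. -/
def graphSubalgebra (e f : X → L) (h : Z → L) (E F : X → Module.End ℂ V)
    (H : Z → Module.End ℂ V) : LieSubalgebra ℂ (L × Module.End ℂ V) :=
  LieSubalgebra.lieSpan ℂ (L × Module.End ℂ V)
    (Set.range (fun x => (e x, E x)) ∪ Set.range (fun x => (f x, F x)) ∪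
      Set.range (fun z => (h z, H z)))

omit [LieAlgebra ℂ L] in
lemma TriData.Rels.prod (r : D.Rels e f h) (r' : D.Rels E F H) :
    D.Rels (fun x => (e x, E x)) (fun x => (f x, F x)) (fun z => (h z, H z)) where
  hh z z' := Prod.ext (r.hh z z') (r'.hh z z')
  he z x := Prod.ext (r.he z x) (r'.he z x)
  hf z x := Prod.ext (r.hf z x) (r'.hf z x)
  ef x y := Prod.ext (r.ef x y) (r'.ef x y)

/-- The operators in the graph over zero move the highest weight vector to lower degrees. -/
lemma TriData.SimpleHW.graph_apply_mem_offEigen (M : D.SimpleHW E F H ψ v) (r : D.Rels e f h)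
    (χ : L →ₗ[ℂ] ℂ) (hχ : ∀ z, ψ z = χ (h z)) {φ : Module.End ℂ V}
    (hφ : ((0 : L), φ) ∈ graphSubalgebra e f h E F H) :
    φ v ∈ offEigen (H D.d) (ψ D.d) := by
  obtain ⟨ab, hab, ⟨c₁, c₂⟩, hc, hsum⟩ :=
    Submodule.mem_sup.1 ((r.prod M.rels).lieSpan_le_triangular hφ)
  obtain ⟨⟨a₁, a₂⟩, ha, ⟨b₁, b₂⟩, hb, rfl⟩ := Submodule.mem_sup.1 hab
  obtain ⟨h0, rfl⟩ := Prod.mk.inj hsum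
  have ha₁ : a₁ ∈ LieSubalgebra.lieSpan ℂ L (Set.range f) := by
    have : LieSubalgebra.lieSpan ℂ _ (Set.range fun x => (f x, F x)) ≤
        (LieSubalgebra.lieSpan ℂ L (Set.range f)).comap (LieHom.fst ℂ L (Module.End ℂ V)) :=
      LieSubalgebra.lieSpan_le.2 (by
        rintro _ ⟨x, rfl⟩; exact LieSubalgebra.subset_lieSpan ⟨x, rfl⟩)
    exact this ha
  have hc₁ : c₁ ∈ LieSubalgebra.lieSpan ℂ L (Set.range e) := by
    have : LieSubalgebra.lieSpan ℂ _ (Set.range fun x => (e x, E x)) ≤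
        (LieSubalgebra.lieSpan ℂ L (Set.range e)).comap (LieHom.fst ℂ L (Module.End ℂ V)) :=
      LieSubalgebra.lieSpan_le.2 (by
        rintro _ ⟨x, rfl⟩; exact LieSubalgebra.subset_lieSpan ⟨x, rfl⟩)
    exact this hc
  have ha₂ : ∀ w, a₂ w ∈ offEigen (H D.d) (ψ D.d) := by
    have key : ∀ p ∈ LieSubalgebra.lieSpan ℂ _ (Set.range fun x => (f x, F x)),
        ∀ w, p.2 w ∈ offEigen (H D.d) (ψ D.d) := by
      intro p hp
      induction hp using LieSubalgebra.lieSpan_induction with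
      | mem p hp => obtain ⟨x, rfl⟩ := hp; exact M.lower_mem_offEigen x
      | zero => intro w; exact zero_mem _
      | smul k p _ ih => intro w; exact Submodule.smul_mem _ k (ih w)
      | add p q _ _ ihp ihq => intro w; exact add_mem (ihp w) (ihq w)
      | lie p q _ _ ihp ihq => intro w; exact sub_mem (ihp _) (ihq _)
    exact key _ ha
  have hc₂ : c₂ v = 0 := by
    have key : ∀ p ∈ LieSubalgebra.lieSpan ℂ _ (Set.range fun x => (e x, E x)), p.2 v = 0 := by
      intro p hp
      induction hp using LieSubalgebra.lieSpan_induction with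
      | mem p hp => obtain ⟨x, rfl⟩ := hp; exact M.raise x
      | zero => rfl
      | smul k p _ ih => change k • p.2 v = 0; rw [ih, smul_zero]
      | add p q _ _ ihp ihq => change p.2 v + q.2 v = 0; rw [ihp, ihq, add_zero]
      | lie p q _ _ ihp ihq =>
        change p.2 (q.2 v) - q.2 (p.2 v) = 0
        rw [ihp, ihq, map_zero, map_zero, sub_zero]
    exact key _ hc
  -- Linearity of the weight on `L` makes the scalar by which `b₂` acts on `v` depend only on `b₁`,
  -- whatever the linear relations among the `h z`.
  have hb' : b₂ v = χ b₁ • v ∧ ⁅h D.d, b₁⁆ = 0 := by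
    have key : ∀ p ∈ Submodule.span ℂ (Set.range fun z => (h z, H z)),
        p.2 v = χ p.1 • v ∧ ⁅h D.d, p.1⁆ = 0 := by
      intro p hp
      induction hp using Submodule.span_induction with
      | mem p hp => obtain ⟨z, rfl⟩ := hp; exact ⟨by rw [M.weight, hχ], r.hh _ _⟩
      | zero => simp
      | smul k p _ ih => simp [ih.1, ih.2, smul_smul]
      | add p q _ _ ihp ihq => simp [ihp.1, ihp.2, ihq.1, ihq.2, add_smul]
    exact key _ hb
  -- `b₁` commutes with `h D.d`, yet equals `-a₁ - c₁`, where only nonzero eigenvalues occur.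
  have hb₀ : b₁ = 0 := by
    refine eq_zero_of_mem_offEigen (T := LieAlgebra.ad ℂ L (h D.d)) (c := 0)
      (by rw [LieAlgebra.ad_apply, hb'.2, zero_smul]) ?_
    have : b₁ = -a₁ - c₁ := by
      have : a₁ + b₁ + c₁ = 0 := h0
      rw [← sub_eq_zero, ← this]; abel
    rw [this]
    refine sub_mem (neg_mem (lieSpan_le_offEigen _ (-1) (by simp) ?_ ha₁))
      (lieSpan_le_offEigen _ 1 one_ne_zero ?_ hc₁)
    · rintro _ ⟨x, rfl⟩
      rw [r.hf, D.act_d, neg_one_smul]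
    · rintro _ ⟨x, rfl⟩
      rw [r.he, D.act_d, one_smul]
  change (a₂ + b₂ + c₂) v ∈ _
  rw [LinearMap.add_apply, LinearMap.add_apply, hc₂, hb'.1, hb₀, map_zero, zero_smul, add_zero,
    add_zero]
  exact ha₂ v

/-- The operators lying over zero form a space `K` stable under commutators with all generators. As
`E x v = 0`, the subspace `K v` is raising-stable; it has no component along `v`, so it is zero.
Commuting with the lowering operators then shows that `K` kills all of `V`. -/
lemma TriData.SimpleHW.graph_eq_zero (M : D.SimpleHW E F H ψ v) (r : D.Rels e f h)
    (χ : L →ₗ[ℂ] ℂ) (hχ : ∀ z, ψ z = χ (h z)) {φ : Module.End ℂ V}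
    (hφ : ((0 : L), φ) ∈ graphSubalgebra e f h E F H) : φ = 0 := by
  set G := graphSubalgebra e f h E F H with hG
  let K : Submodule ℂ (Module.End ℂ V) := G.toSubmodule.comap (LinearMap.inr ℂ L (Module.End ℂ V))
  have hK : ∀ φ : Module.End ℂ V, φ ∈ K ↔ ((0 : L), φ) ∈ G := fun _ => Iff.rfl
  have hlie : ∀ p ∈ G, ∀ φ ∈ K, ⁅p.2, φ⁆ ∈ K := by
    intro p hp φ hφ
    have := LieSubalgebra.lie_mem G hp ((hK φ).1 hφ)
    rwa [show ⁅p, ((0 : L), φ)⁆ = (0, ⁅p.2, φ⁆) from Prod.ext (lie_zero p.1) rfl] at this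
  have hE : ∀ x, (e x, E x) ∈ G := fun x =>
    LieSubalgebra.subset_lieSpan (Or.inl (Or.inl ⟨x, rfl⟩))
  have hF : ∀ x, (f x, F x) ∈ G := fun x =>
    LieSubalgebra.subset_lieSpan (Or.inl (Or.inr ⟨x, rfl⟩))
  have hv : K.map (LinearMap.applyₗ (R := ℂ) v) = ⊥ := by
    refine M.eq_bot_of_le_offEigen ?_ ?_
    · rintro x _ ⟨φ, hφ, rfl⟩
      refine ⟨⁅E x, φ⁆, hlie _ (hE x) φ hφ, ?_⟩
      simp [LieRing.of_associative_ring_bracket, M.raise]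
    · rintro _ ⟨φ, hφ, rfl⟩
      exact M.graph_apply_mem_offEigen r χ hχ hφ
  have htop : (⨅ φ : K, LinearMap.ker φ.1) = ⊤ := by
    refine M.gen _ ?_ ?_
    · rw [Submodule.mem_iInf]
      rintro ⟨φ, hφ⟩
      exact (Submodule.mem_bot ℂ).1 (hv ▸ (⟨φ, hφ, rfl⟩ : φ v ∈ K.map (LinearMap.applyₗ v)))
    · intro x w hw
      rw [Submodule.mem_iInf] at hw ⊢
      rintro ⟨φ, hφ⟩
      have h1 := hw ⟨φ, hφ⟩
      have h2 := hw ⟨⁅F x, φ⁆, hlie _ (hF x) φ hφ⟩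
      simp only [LinearMap.mem_ker] at h1 h2 ⊢
      simpa [LieRing.of_associative_ring_bracket, h1] using h2
  ext w
  have hw : w ∈ ⨅ φ : K, LinearMap.ker φ.1 := htop ▸ Submodule.mem_top
  exact (Submodule.mem_iInf _).1 hw ⟨φ, hφ⟩

/-- The action of generators on an irreducible highest weight module extends to an action of any
Lie algebra generated by elements satisfying the relations, provided the highest weight is
well defined there. -/
theorem TriData.SimpleHW.exists_lieHom (M : D.SimpleHW E F H ψ v) (r : D.Rels e f h)
    (gen : LieSubalgebra.lieSpan ℂ L (Set.range e ∪ Set.range f ∪ Set.range h) = ⊤)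
    (χ : L →ₗ[ℂ] ℂ) (hχ : ∀ z, ψ z = χ (h z)) :
    ∃ ρ : L →ₗ⁅ℂ⁆ Module.End ℂ V,
      (∀ x, ρ (e x) = E x) ∧ (∀ x, ρ (f x) = F x) ∧ ∀ z, ρ (h z) = H z := by
  set G := graphSubalgebra e f h E F H with hG
  let π : G →ₗ⁅ℂ⁆ L := (LieHom.fst ℂ L (Module.End ℂ V)).comp G.incl
  have hE : ∀ x, (e x, E x) ∈ G := fun x =>
    LieSubalgebra.subset_lieSpan (Or.inl (Or.inl ⟨x, rfl⟩))
  have hF : ∀ x, (f x, F x) ∈ G := fun x =>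
    LieSubalgebra.subset_lieSpan (Or.inl (Or.inr ⟨x, rfl⟩))
  have hH : ∀ z, (h z, H z) ∈ G := fun z =>
    LieSubalgebra.subset_lieSpan (Or.inr ⟨z, rfl⟩)
  -- The graph algebra projects isomorphically onto `L`; the inverse followed by the second
  -- projection is the desired action.
  have hinj : Function.Injective π := by
    rw [injective_iff_map_eq_zero]
    rintro ⟨⟨a, φ⟩, hp⟩ h0
    obtain rfl : a = 0 := h0
    exact Subtype.ext (Prod.ext rfl (M.graph_eq_zero r χ hχ hp))
  have hsurj : Function.Surjective π := by
    rw [← LieHom.range_eq_top, eq_top_iff, ← gen, LieSubalgebra.lieSpan_le]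
    rintro _ ((⟨x, rfl⟩ | ⟨x, rfl⟩) | ⟨z, rfl⟩)
    · exact ⟨⟨_, hE x⟩, rfl⟩
    · exact ⟨⟨_, hF x⟩, rfl⟩
    · exact ⟨⟨_, hH z⟩, rfl⟩
  let θ : G ≃ₗ⁅ℂ⁆ L := LieEquiv.ofBijective π ⟨hinj, hsurj⟩
  have hθ : ∀ p : G, θ.symm p.1.1 = p := fun p => θ.symm_apply_apply p
  refine ⟨((LieHom.snd ℂ L (Module.End ℂ V)).comp G.incl).comp θ.symm.toLieHom,
    fun x => ?_, fun x => ?_, fun z => ?_⟩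
  · exact congrArg (fun p : G => p.1.2) (hθ ⟨_, hE x⟩)
  · exact congrArg (fun p : G => p.1.2) (hθ ⟨_, hF x⟩)
  · exact congrArg (fun p : G => p.1.2) (hθ ⟨_, hH z⟩)

end Graph

/-! ### Chevalley generators of the Kac-Moody algebra -/

section Chevalley

variable {ι : Type*} [Fintype ι] [DecidableEq ι] {C : Matrix ι ι ℤ}
  {H : Type*} [AddCommGroup H] [Module ℂ H]

/-- The positive Chevalley generators. -/
def kmE (R : Realization C H) (i : ι) : KM R := kmMk R (auxMk R (fe H i))

/-- The negative Chevalley generators. -/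
def kmF (R : Realization C H) (i : ι) : KM R := kmMk R (auxMk R (ff H i))

/-- The map from `H` onto the Cartan subalgebra. -/
def kmH (R : Realization C H) : H →ₗ[ℂ] KM R := (kmMk R : Aux R →ₗ[ℂ] KM R) ∘ₗ auxCartanMap R

variable (R : Realization C H)

lemma kmH_apply (x : H) : kmH R x = kmMk R (auxMk R (fh ι x)) := rfl

lemma auxMk_eq_zero {a : FreeLieAlgebra ℂ (Gen ι H)} (h : Rel R a) : auxMk R a = 0 :=
  (LieSubmodule.Quotient.mk_eq_zero _).2 (LieSubmodule.subset_lieSpan h)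

lemma lie_kmH_kmH (x y : H) : ⁅kmH R x, kmH R y⁆ = 0 := by
  rw [kmH_apply, kmH_apply, ← LieHom.map_lie, ← LieHom.map_lie, auxMk_eq_zero R (.hh x y), map_zero]

lemma lie_kmH_kmE (x : H) (i : ι) : ⁅kmH R x, kmE R i⁆ = R.root i x • kmE R i := by
  have h := auxMk_eq_zero R (.he x i)
  rw [map_sub, map_smul, sub_eq_zero] at h
  rw [kmH_apply, kmE, ← LieHom.map_lie, ← LieHom.map_lie, h, map_smul]

lemma lie_kmH_kmF (x : H) (i : ι) : ⁅kmH R x, kmF R i⁆ = -(R.root i x • kmF R i) := by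
  have h := auxMk_eq_zero R (.hf x i)
  rw [map_add, map_smul, add_eq_zero_iff_eq_neg] at h
  rw [kmH_apply, kmF, ← LieHom.map_lie, ← LieHom.map_lie, h, map_neg, map_smul]

lemma lie_kmE_kmF (i : ι) : ⁅kmE R i, kmF R i⁆ = kmH R (R.coroot i) := by
  have h := auxMk_eq_zero R (.ef i)
  rw [map_sub, sub_eq_zero] at h
  rw [kmH_apply, kmE, kmF, ← LieHom.map_lie, ← LieHom.map_lie, h]

lemma lie_kmE_kmF_of_ne {i j : ι} (hij : i ≠ j) : ⁅kmE R i, kmF R j⁆ = 0 := by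
  rw [kmE, kmF, ← LieHom.map_lie, ← LieHom.map_lie, auxMk_eq_zero R (.ef_ne i j hij), map_zero]

lemma freeLieAlgebra_lieSpan_of (Y : Type*) :
    LieSubalgebra.lieSpan ℂ (FreeLieAlgebra ℂ Y) (Set.range (FreeLieAlgebra.of ℂ)) = ⊤ := by
  set S := LieSubalgebra.lieSpan ℂ (FreeLieAlgebra ℂ Y) (Set.range (FreeLieAlgebra.of ℂ))
  let φ : FreeLieAlgebra ℂ Y →ₗ⁅ℂ⁆ S := FreeLieAlgebra.lift ℂ fun y =>
    ⟨FreeLieAlgebra.of ℂ y, LieSubalgebra.subset_lieSpan ⟨y, rfl⟩⟩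
  have h : S.incl.comp φ = LieHom.id := FreeLieAlgebra.hom_ext (by simp [φ])
  rw [eq_top_iff]
  intro a _
  have := congrArg (fun g : FreeLieAlgebra ℂ Y →ₗ⁅ℂ⁆ FreeLieAlgebra ℂ Y => g a) h
  simp only [LieHom.comp_apply, LieHom.id_apply] at this
  rw [← this]
  exact (φ a).2

lemma km_lieSpan : LieSubalgebra.lieSpan ℂ (KM R)
    (Set.range (kmE R) ∪ Set.range (kmF R) ∪ Set.range (kmH R)) = ⊤ := by
  set S := LieSubalgebra.lieSpan ℂ (KM R)
    (Set.range (kmE R) ∪ Set.range (kmF R) ∪ Set.range (kmH R)) with hS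
  have h : (⊤ : LieSubalgebra ℂ (FreeLieAlgebra ℂ (Gen ι H))) ≤
      S.comap ((kmMk R).comp (auxMk R)) := by
    rw [← freeLieAlgebra_lieSpan_of, LieSubalgebra.lieSpan_le]
    rintro _ ⟨i | i | x, rfl⟩
    · exact LieSubalgebra.subset_lieSpan (Or.inl (Or.inl ⟨i, rfl⟩))
    · exact LieSubalgebra.subset_lieSpan (Or.inl (Or.inr ⟨i, rfl⟩))
    · exact LieSubalgebra.subset_lieSpan (Or.inr ⟨x, rfl⟩)
  rw [eq_top_iff]
  intro a _
  obtain ⟨a, rfl⟩ : ∃ b, kmMk R b = a := Submodule.Quotient.mk_surjective _ a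
  obtain ⟨a, rfl⟩ : ∃ b, auxMk R b = a := Submodule.Quotient.mk_surjective _ a
  exact h (x := a) trivial

/-- The subalgebra generated by the Chevalley generators. -/
def chevalleySpan : LieSubalgebra ℂ (KM R) :=
  LieSubalgebra.lieSpan ℂ (KM R) (Set.range (kmE R) ∪ Set.range (kmF R))

lemma lie_kmH_mem_chevalleySpan (x : H) {a : KM R} (ha : a ∈ chevalleySpan R) :
    ⁅kmH R x, a⁆ ∈ chevalleySpan R := by
  rw [chevalleySpan] at ha ⊢
  induction ha using LieSubalgebra.lieSpan_induction with
  | mem a ha =>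
    rcases ha with ⟨i, rfl⟩ | ⟨i, rfl⟩
    · rw [lie_kmH_kmE]
      exact SMulMemClass.smul_mem _ (LieSubalgebra.subset_lieSpan (Or.inl ⟨i, rfl⟩))
    · rw [lie_kmH_kmF]
      exact neg_mem (SMulMemClass.smul_mem _ (LieSubalgebra.subset_lieSpan (Or.inr ⟨i, rfl⟩)))
  | zero => rw [lie_zero]; exact zero_mem _
  | smul c a _ ih => rw [lie_smul]; exact SMulMemClass.smul_mem c ih
  | add a b _ _ iha ihb => rw [lie_add]; exact add_mem iha ihb
  | lie a b ha hb iha ihb =>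
    rw [leibniz_lie]
    exact add_mem (LieSubalgebra.lie_mem _ iha hb) (LieSubalgebra.lie_mem _ ha ihb)

lemma lie_mem_chevalleySpan_of_mem_sup {a b : KM R}
    (ha : a ∈ (chevalleySpan R).toSubmodule ⊔ (kmH R).range)
    (hb : b ∈ (chevalleySpan R).toSubmodule ⊔ (kmH R).range) : ⁅a, b⁆ ∈ chevalleySpan R := by
  obtain ⟨a, ha', _, ⟨x, rfl⟩, rfl⟩ := Submodule.mem_sup.1 ha
  obtain ⟨b, hb', _, ⟨y, rfl⟩, rfl⟩ := Submodule.mem_sup.1 hb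
  clear ha hb
  rw [lie_add, add_lie, add_lie, lie_kmH_kmH, add_zero, ← lie_skew a (kmH R y)]
  exact add_mem (add_mem (LieSubalgebra.lie_mem _ ha' hb') (lie_kmH_mem_chevalleySpan R x hb'))
    (neg_mem (lie_kmH_mem_chevalleySpan R y ha'))

lemma chevalleySpan_sup_range : (chevalleySpan R).toSubmodule ⊔ (kmH R).range = ⊤ := by
  let S : LieSubalgebra ℂ (KM R) :=
    { toSubmodule := (chevalleySpan R).toSubmodule ⊔ (kmH R).range
      lie_mem' := fun ha hb =>
        Submodule.mem_sup_left (lie_mem_chevalleySpan_of_mem_sup R ha hb) }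
  have hS : (⊤ : LieSubalgebra ℂ (KM R)) ≤ S := by
    rw [← km_lieSpan R, LieSubalgebra.lieSpan_le]
    rintro _ ((⟨i, rfl⟩ | ⟨i, rfl⟩) | ⟨x, rfl⟩)
    · exact Submodule.mem_sup_left (LieSubalgebra.subset_lieSpan (Or.inl ⟨i, rfl⟩))
    · exact Submodule.mem_sup_left (LieSubalgebra.subset_lieSpan (Or.inr ⟨i, rfl⟩))
    · exact Submodule.mem_sup_right ⟨x, rfl⟩
  exact top_le_iff.1 hS

/-- `𝔤` is the sum of the Chevalley span and the abelian `𝔥`, which normalizes that span; so every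
bracket falls in the span. -/
lemma derived_le_chevalleySpan : (derived R).toSubmodule ≤ (chevalleySpan R).toSubmodule := by
  rw [derived, LieSubmodule.lieIdeal_oper_eq_linear_span', Submodule.span_le]
  rintro _ ⟨a, -, b, -, rfl⟩
  exact lie_mem_chevalleySpan_of_mem_sup R (chevalleySpan_sup_range R ▸ Submodule.mem_top)
    (chevalleySpan_sup_range R ▸ Submodule.mem_top)

lemma lie_mem_derived (a b : KM R) : ⁅a, b⁆ ∈ derived R :=
  LieSubmodule.lie_mem_lie (LieSubmodule.mem_top a) (LieSubmodule.mem_top b)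

variable {R} (hC : IsGCM C)
include hC

lemma root_coroot (i : ι) : R.root i (R.coroot i) = 2 := by
  rw [R.pairing, hC.diag]; norm_num

/-- The bracket of the coroot with `e_i` is `2 e_i`. -/
lemma kmE_mem_derived (i : ι) : kmE R i ∈ derived R := by
  have h := lie_mem_derived R (kmH R (R.coroot i)) (kmE R i)
  rw [lie_kmH_kmE, root_coroot hC] at h
  exact ((derived R).toSubmodule.smul_mem_iff two_ne_zero).1 h

lemma kmF_mem_derived (i : ι) : kmF R i ∈ derived R := by
  have h := lie_mem_derived R (kmH R (R.coroot i)) (kmF R i)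
  rw [lie_kmH_kmF, root_coroot hC] at h
  exact ((derived R).toSubmodule.smul_mem_iff two_ne_zero).1 (neg_mem_iff.1 h)

omit hC in
lemma kmH_coroot_mem_cartan' (i : ι) : kmH R (R.coroot i) ∈ cartan' R :=
  ⟨⟨_, rfl⟩, lie_kmE_kmF R i ▸ lie_mem_derived R _ _⟩

omit hC in
/-- An element of `H` on which all simple roots take the value one. -/
lemma exists_root_eq_one (R : Realization C H) : ∃ x : H, ∀ i, R.root i x = 1 := by
  have := R.finite
  -- By independence of the roots some functional on the dual of `H` sends each root to 1; by
  -- reflexivity it is evaluation at a point of `H`.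
  obtain ⟨Φ, hΦ⟩ := LinearMap.exists_extend
    ((Module.Basis.span R.root_indep).constr ℂ (fun _ => (1 : ℂ)))
  refine ⟨(Module.evalEquiv ℂ H).symm Φ, fun i => ?_⟩
  have h : Φ (R.root i) = 1 := by
    have h1 := (Module.Basis.span R.root_indep).constr_basis ℂ (fun _ => (1 : ℂ)) i
    rw [← hΦ] at h1
    simpa [Module.Basis.span_apply] using h1
  rw [← h]
  exact Module.apply_evalEquiv_symm_apply ℂ H (R.root i) Φ

end Chevalley

/-! ### Generators of the loop algebra -/

section Loop

variable {ι : Type*} [Fintype ι] [DecidableEq ι] {C : Matrix ι ι ℤ}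
  {H : Type*} [AddCommGroup H] [Module ℂ H]

lemma tensorSub_induction {n : ℕ} {R : Realization C H} {S : Submodule ℂ (KM R)}
    {T : Submodule ℂ (Laurent n ⊗[ℂ] KM R)} (h : ∀ p, ∀ x ∈ S, p ⊗ₜ[ℂ] x ∈ T) :
    tensorSub n S ≤ T := by
  intro y hy
  obtain ⟨y, rfl⟩ := hy
  induction y using TensorProduct.induction_on with
  | zero => rw [map_zero]; exact zero_mem _
  | add a b ha hb => rw [map_add]; exact add_mem ha hb
  | tmul p x => exact h p x x.2

lemma tensorSub_mono {n : ℕ} {R : Realization C H} {S T : Submodule ℂ (KM R)} (h : S ≤ T) :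
    tensorSub n S ≤ tensorSub n T :=
  tensorSub_induction fun p _ hx => Submodule.tmul_mem_baseChange_of_mem p (h hx)

/-- `p ⊗ [a, b] = [p ⊗ a, 1 ⊗ b]`, so the coefficient is carried by one factor throughout the
induction. -/
lemma tensorSub_lieSpan_le {n : ℕ} {R : Realization C H} {s : Set (KM R)}
    {G : LieSubalgebra ℂ (Laurent n ⊗[ℂ] KM R)} (h : ∀ p, ∀ x ∈ s, p ⊗ₜ[ℂ] x ∈ G) :
    tensorSub n (LieSubalgebra.lieSpan ℂ (KM R) s).toSubmodule ≤ G.toSubmodule := by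
  refine tensorSub_induction fun p x hx => ?_
  change p ⊗ₜ[ℂ] x ∈ G
  have hx' : x ∈ LieSubalgebra.lieSpan ℂ (KM R) s := hx
  clear hx
  induction hx' using LieSubalgebra.lieSpan_induction generalizing p with
  | mem x hx => exact h p x hx
  | zero => rw [TensorProduct.tmul_zero]; exact zero_mem G
  | smul c a _ ih => rw [TensorProduct.tmul_smul]; exact SMulMemClass.smul_mem c (ih p)
  | add a b ha hb iha ihb => rw [TensorProduct.tmul_add]; exact add_mem (iha p) (ihb p)
  | lie a b ha hb iha ihb =>
    have := LieSubalgebra.lie_mem G (iha p) (ihb 1)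
    rwa [LieAlgebra.ExtendScalars.bracket_tmul, mul_one] at this

variable {n : ℕ} {R : Realization C H} {W : Submodule ℂ (KM R)}

/-- The map `A ⊗ H → A ⊗ 𝔤`. -/
def loopH (n : ℕ) (R : Realization C H) : Laurent n ⊗[ℂ] H →ₗ[ℂ] Laurent n ⊗[ℂ] KM R :=
  (kmH R).lTensor (Laurent n)

/-- The `A`-valued extension of a simple root. -/
def loopRoot (n : ℕ) (R : Realization C H) (i : ι) : Laurent n ⊗[ℂ] H →ₗ[ℂ] Laurent n :=
  (TensorProduct.rid ℂ (Laurent n)).toLinearMap ∘ₗ (R.root i).lTensor (Laurent n)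

lemma loopRoot_tmul (i : ι) (p : Laurent n) (x : H) :
    loopRoot n R i (p ⊗ₜ x) = R.root i x • p := by
  simp [loopRoot]

lemma lie_loopH_kmE (z : Laurent n ⊗[ℂ] H) (p : Laurent n) (i : ι) :
    ⁅loopH n R z, p ⊗ₜ[ℂ] kmE R i⁆ = (loopRoot n R i z * p) ⊗ₜ[ℂ] kmE R i := by
  induction z using TensorProduct.induction_on with
  | zero =>
    rw [map_zero, map_zero, zero_mul, TensorProduct.zero_tmul]
    exact zero_lie (p ⊗ₜ[ℂ] kmE R i)
  | add a b ha hb =>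
    rw [map_add, map_add, add_mul, TensorProduct.add_tmul, ← ha, ← hb]
    exact add_lie (loopH n R a) (loopH n R b) (p ⊗ₜ[ℂ] kmE R i)
  | tmul q x =>
    rw [loopH, LinearMap.lTensor_tmul, LieAlgebra.ExtendScalars.bracket_tmul, lie_kmH_kmE,
      loopRoot_tmul, smul_mul_assoc, TensorProduct.tmul_smul, TensorProduct.smul_tmul']

lemma lie_loopH_kmF (z : Laurent n ⊗[ℂ] H) (p : Laurent n) (i : ι) :
    ⁅loopH n R z, p ⊗ₜ[ℂ] kmF R i⁆ = -((loopRoot n R i z * p) ⊗ₜ[ℂ] kmF R i) := by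
  induction z using TensorProduct.induction_on with
  | zero =>
    rw [map_zero, map_zero, zero_mul, TensorProduct.zero_tmul, neg_zero]
    exact zero_lie (p ⊗ₜ[ℂ] kmF R i)
  | add a b ha hb =>
    rw [map_add, map_add, add_mul, TensorProduct.add_tmul, neg_add, ← ha, ← hb]
    exact add_lie (loopH n R a) (loopH n R b) (p ⊗ₜ[ℂ] kmF R i)
  | tmul q x =>
    rw [loopH, LinearMap.lTensor_tmul, LieAlgebra.ExtendScalars.bracket_tmul, lie_kmH_kmF,
      loopRoot_tmul, smul_mul_assoc, TensorProduct.tmul_neg, TensorProduct.tmul_smul,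
      TensorProduct.smul_tmul']

lemma lie_loopH_loopH (z z' : Laurent n ⊗[ℂ] H) : ⁅loopH n R z, loopH n R z'⁆ = 0 := by
  induction z using TensorProduct.induction_on with
  | zero => rw [map_zero]; exact zero_lie (loopH n R z')
  | add a b ha hb =>
    rw [map_add]
    exact (add_lie (loopH n R a) (loopH n R b) (loopH n R z')).trans (by rw [ha, hb, add_zero])
  | tmul q x =>
    induction z' using TensorProduct.induction_on with
    | zero => rw [map_zero]; exact lie_zero (loopH n R (q ⊗ₜ x))
    | add a b ha hb =>
      rw [map_add]
      exact (lie_add (loopH n R (q ⊗ₜ x)) (loopH n R a) (loopH n R b)).trans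
        (by rw [ha, hb, add_zero])
    | tmul q' x' =>
      rw [loopH, LinearMap.lTensor_tmul, LinearMap.lTensor_tmul,
        LieAlgebra.ExtendScalars.bracket_tmul, lie_kmH_kmH, TensorProduct.tmul_zero]

/-- The preimage of `𝔥_A` in `A ⊗ H`. -/
def loopCartan (n : ℕ) (R : Realization C H) (W : Submodule ℂ (KM R)) :
    Submodule ℂ (Laurent n ⊗[ℂ] H) :=
  (tensorSub n (cartan' R) ⊔ constSub n W).comap (loopH n R)

lemma tensorSub_cartan'_sup_le :
    tensorSub n (cartan' R) ⊔ constSub n W ≤ (gA n R W).toSubmodule :=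
  sup_le_sup_right (tensorSub_mono inf_le_right) _

/-- The diagonal generators of `𝔤_A`. -/
def loopCartanMap (n : ℕ) (R : Realization C H) (W : Submodule ℂ (KM R)) :
    loopCartan n R W →ₗ[ℂ] hA n R W :=
  ((loopH n R ∘ₗ (loopCartan n R W).subtype).codRestrict (gA n R W).toSubmodule
    fun z => tensorSub_cartan'_sup_le z.2).codRestrict (hA n R W) fun z => z.2

/-- Indexing diagonal elements by `A ⊗ H`, where the roots are defined, makes injectivity of `H → 𝔤`
unnecessary; it suffices that `𝔥'` and `W` lie in the image of `H`. -/
lemma loopCartanMap_surjective (hW : W ≤ cartan R) :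
    Function.Surjective (loopCartanMap n R W) := by
  rintro ⟨⟨y, hy⟩, hy'⟩
  have hle : tensorSub n (cartan' R) ⊔ constSub n W ≤ (loopH n R).range := by
    refine sup_le (tensorSub_induction ?_) ?_
    · rintro p _ ⟨⟨x, rfl⟩, -⟩
      exact ⟨p ⊗ₜ x, rfl⟩
    · rintro _ ⟨w, hw, rfl⟩
      obtain ⟨x, rfl⟩ := hW hw
      exact ⟨1 ⊗ₜ x, rfl⟩
  obtain ⟨z, rfl⟩ := hle hy'
  exact ⟨⟨z, hy'⟩, rfl⟩

/-- The element `p ⊗ h` of `A ⊗ H`, where `h` is a simple coroot. -/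
def loopCoroot (n : ℕ) (R : Realization C H) (W : Submodule ℂ (KM R)) (i : ι) (p : Laurent n) :
    loopCartan n R W :=
  ⟨p ⊗ₜ R.coroot i, Submodule.mem_sup_left
    (Submodule.tmul_mem_baseChange_of_mem p (kmH_coroot_mem_cartan' i))⟩

/-- The raising generators of `𝔤_A`. -/
def loopE (hC : IsGCM C) (n : ℕ) (R : Realization C H) (W : Submodule ℂ (KM R))
    (x : ι × Laurent n) : gA n R W :=
  ⟨x.2 ⊗ₜ[ℂ] kmE R x.1, Submodule.mem_sup_left
    (Submodule.tmul_mem_baseChange_of_mem _ (kmE_mem_derived hC x.1))⟩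

/-- The lowering generators of `𝔤_A`. -/
def loopF (hC : IsGCM C) (n : ℕ) (R : Realization C H) (W : Submodule ℂ (KM R))
    (x : ι × Laurent n) : gA n R W :=
  ⟨x.2 ⊗ₜ[ℂ] kmF R x.1, Submodule.mem_sup_left
    (Submodule.tmul_mem_baseChange_of_mem _ (kmF_mem_derived hC x.1))⟩

/-- The principal grading element `1 ⊗ x` lies over `𝔥_A` because `𝔥` is covered by `𝔥' + 𝔥''`. -/
lemma exists_loopCartan_root_eq_one (hW : cartan R ≤ cartan' R ⊔ W) :
    ∃ d : loopCartan n R W, ∀ i, loopRoot n R i d = 1 := by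
  obtain ⟨x, hx⟩ := exists_root_eq_one R
  obtain ⟨a, ha, b, hb, hab⟩ := Submodule.mem_sup.1 (hW ⟨x, rfl⟩ : kmH R x ∈ _)
  refine ⟨⟨1 ⊗ₜ x, ?_⟩, fun i => by rw [loopRoot_tmul, hx, one_smul]⟩
  change (1 : Laurent n) ⊗ₜ[ℂ] kmH R x ∈ tensorSub n (cartan' R) ⊔ constSub n W
  rw [← hab, TensorProduct.tmul_add]
  exact add_mem (Submodule.mem_sup_left (Submodule.tmul_mem_baseChange_of_mem _ ha))
    (Submodule.mem_sup_right ⟨b, hb, rfl⟩)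

/-- The triangular data of the loop algebra. -/
def loopData (d : loopCartan n R W) (hd : ∀ i, loopRoot n R i d = 1) :
    TriData (ι × Laurent n) (loopCartan n R W) where
  act z x := (x.1, loopRoot n R x.1 z * x.2)
  t x y := if x.1 = y.1 then loopCoroot n R W x.1 (x.2 * y.2) else 0
  d := d
  act_comm z z' x := Prod.ext rfl (mul_left_comm _ _ _)
  t_act z x y := by
    by_cases h : x.1 = y.1
    · simp only [h, if_true]
      rw [mul_left_comm, mul_assoc]
    · simp only [h, if_false]
  act_d x := Prod.ext rfl (by rw [hd, one_mul])

variable (hC : IsGCM C)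
include hC

lemma loop_rels (d : loopCartan n R W) (hd : ∀ i, loopRoot n R i d = 1) :
    (loopData d hd).Rels (loopE hC n R W) (loopF hC n R W)
      (fun z => (loopCartanMap n R W z : gA n R W)) where
  hh z z' := Subtype.ext (lie_loopH_loopH _ _)
  he z x := Subtype.ext (lie_loopH_kmE _ _ _)
  hf z x := Subtype.ext (lie_loopH_kmF _ _ _)
  ef x y := by
    refine Subtype.ext ?_
    change ⁅x.2 ⊗ₜ[ℂ] kmE R x.1, y.2 ⊗ₜ[ℂ] kmF R y.1⁆ = loopH n R ((loopData d hd).t x y)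
    rw [LieAlgebra.ExtendScalars.bracket_tmul]
    simp only [loopData]
    split_ifs with h
    · rw [← h, lie_kmE_kmF]
      rfl
    · rw [lie_kmE_kmF_of_ne R h, TensorProduct.tmul_zero, ZeroMemClass.coe_zero, map_zero]

lemma loop_lieSpan (hW : W ≤ cartan R) : LieSubalgebra.lieSpan ℂ (gA n R W)
    (Set.range (loopE hC n R W) ∪ Set.range (loopF hC n R W) ∪
      Set.range (fun z => (loopCartanMap n R W z : gA n R W))) = ⊤ := by
  set G := LieSubalgebra.lieSpan ℂ (gA n R W)
    (Set.range (loopE hC n R W) ∪ Set.range (loopF hC n R W) ∪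
      Set.range (fun z => (loopCartanMap n R W z : gA n R W)))
  have h1 : tensorSub n (derived R).toSubmodule ≤ (G.map (gA n R W).incl).toSubmodule := by
    refine (tensorSub_mono (derived_le_chevalleySpan R)).trans (tensorSub_lieSpan_le ?_)
    rintro p _ (⟨i, rfl⟩ | ⟨i, rfl⟩)
    · exact ⟨loopE hC n R W (i, p),
        LieSubalgebra.subset_lieSpan (Or.inl (Or.inl ⟨(i, p), rfl⟩)), rfl⟩
    · exact ⟨loopF hC n R W (i, p),
        LieSubalgebra.subset_lieSpan (Or.inl (Or.inr ⟨(i, p), rfl⟩)), rfl⟩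
  have h2 : constSub n W ≤ (G.map (gA n R W).incl).toSubmodule := by
    rintro y hy
    obtain ⟨z, hz⟩ := loopCartanMap_surjective (n := n) hW
      ⟨⟨y, Submodule.mem_sup_right hy⟩, Submodule.mem_sup_right hy⟩
    refine ⟨loopCartanMap n R W z, LieSubalgebra.subset_lieSpan (Or.inr ⟨z, rfl⟩), ?_⟩
    rw [hz]
    rfl
  rw [eq_top_iff]
  rintro ⟨y, hy⟩ -
  obtain ⟨y', hy', he⟩ := sup_le h1 h2 hy
  obtain rfl : y' = ⟨y, hy⟩ := Subtype.ext he
  exact hy'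

lemma loopE_mem_nA (x : ι × Laurent n) : loopE hC n R W x ∈ nA n R W :=
  Submodule.tmul_mem_baseChange_of_mem x.2 (LieSubalgebra.subset_lieSpan ⟨x.1, rfl⟩)

/-- A subalgebra of `𝔤_A` containing the raising generators contains `N⁺ ⊗ A`. -/
lemma nA_le {G : LieSubalgebra ℂ (gA n R W)} (hG : ∀ x, loopE hC n R W x ∈ G) :
    nA n R W ≤ G.toSubmodule := by
  rintro ⟨y, hy⟩ hy'
  have h : tensorSub n (nPlus R).toSubmodule ≤ (G.map (gA n R W).incl).toSubmodule := by
    refine tensorSub_lieSpan_le ?_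
    rintro p _ ⟨i, rfl⟩
    exact ⟨loopE hC n R W (i, p), hG _, rfl⟩
  obtain ⟨y', hy'', he⟩ := h hy'
  obtain rfl : y' = ⟨y, hy⟩ := Subtype.ext he
  exact hy''

end Loop

/-! ### The irreducible module `V(ψ)` -/

/-- The universal property gives a map to `S` whose composite with the inclusion is the identity. -/
lemma universalEnvelopingAlgebra_eq_top {L : Type*} [LieRing L] [LieAlgebra ℂ L]
    {S : Subalgebra ℂ (UniversalEnvelopingAlgebra ℂ L)}
    (h : ∀ x : L, UniversalEnvelopingAlgebra.ι ℂ x ∈ S) : S = ⊤ := by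
  let φ : L →ₗ⁅ℂ⁆ S :=
    { toFun := fun x => ⟨UniversalEnvelopingAlgebra.ι ℂ x, h x⟩
      map_add' := fun x y => Subtype.ext (map_add _ x y)
      map_smul' := fun c x => Subtype.ext (map_smul _ c x)
      map_lie' := fun {x y} => Subtype.ext (LieHom.map_lie _ x y) }
  have hφ : S.val.comp (UniversalEnvelopingAlgebra.lift ℂ φ) =
      AlgHom.id ℂ (UniversalEnvelopingAlgebra ℂ L) := by
    refine UniversalEnvelopingAlgebra.hom_ext ℂ (LieHom.ext fun x => ?_)
    change ((UniversalEnvelopingAlgebra.lift ℂ φ (UniversalEnvelopingAlgebra.ι ℂ x) : S) :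
      UniversalEnvelopingAlgebra ℂ L) = UniversalEnvelopingAlgebra.ι ℂ x
    rw [UniversalEnvelopingAlgebra.lift_ι_apply]
    rfl
  rw [eq_top_iff]
  intro u _
  have : S.val (UniversalEnvelopingAlgebra.lift ℂ φ u) = u := DFunLike.congr_fun hφ u
  rw [← this]
  exact (UniversalEnvelopingAlgebra.lift ℂ φ u).2

lemma toEnd_tensor {𝔏 V₁ V₂ : Type*} [LieRing 𝔏] [LieAlgebra ℂ 𝔏]
    [AddCommGroup V₁] [Module ℂ V₁] [LieRingModule 𝔏 V₁] [LieModule ℂ 𝔏 V₁]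
    [AddCommGroup V₂] [Module ℂ V₂] [LieRingModule 𝔏 V₂] [LieModule ℂ 𝔏 V₂] (x : 𝔏) :
    LieModule.toEnd ℂ 𝔏 (V₁ ⊗[ℂ] V₂) x =
      (LieModule.toEnd ℂ 𝔏 V₁ x).rTensor V₂ + (LieModule.toEnd ℂ 𝔏 V₂ x).lTensor V₁ := by
  ext a b
  simp [TensorProduct.LieModule.lie_tmul_right]

section

variable {ι : Type*} [Fintype ι] [DecidableEq ι] {C : Matrix ι ι ℤ}
  {H : Type*} [AddCommGroup H] [Module ℂ H] {n : ℕ} {R : Realization C H}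
  {W : Submodule ℂ (KM R)}

/-- The action of `𝔤_A` on `M(ψ)`. -/
def vermaRep (ψ : hA n R W →ₗ[ℂ] ℂ) : gA n R W →ₗ⁅ℂ⁆ Module.End ℂ (M ψ) :=
  (AlgHom.toLieHom (Algebra.lsmul ℂ ℂ (M ψ) : UgA n R W →ₐ[ℂ] _)).comp
    (UniversalEnvelopingAlgebra.ι ℂ)

lemma vermaRep_apply (ψ : hA n R W →ₗ[ℂ] ℂ) (x : gA n R W) (w : M ψ) :
    vermaRep ψ x w = (UniversalEnvelopingAlgebra.ι ℂ x : UgA n R W) • w := rfl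

/-- The canonical generator of `M(ψ)`. -/
def vermaGen (ψ : hA n R W →ₗ[ℂ] ℂ) : M ψ := (vermaIdeal ψ).mkQ 1

lemma smul_vermaGen (ψ : hA n R W →ₗ[ℂ] ℂ) (u : UgA n R W) :
    u • vermaGen ψ = (vermaIdeal ψ).mkQ u := by
  change u • (vermaIdeal ψ).mkQ 1 = _
  rw [← map_smul, smul_eq_mul, mul_one]

lemma exists_smul_vermaGen (ψ : hA n R W →ₗ[ℂ] ℂ) (w : M ψ) : ∃ u : UgA n R W,
    u • vermaGen ψ = w := by
  obtain ⟨u, rfl⟩ := (vermaIdeal ψ).mkQ_surjective w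
  exact ⟨u, smul_vermaGen ψ u⟩

/-- A subspace stable under generators of `𝔤_A` is stable under `U(𝔤_A)`. -/
lemma smul_mem_of_lieSpan {ψ : hA n R W →ₗ[ℂ] ℂ} {s : Set (gA n R W)}
    (hs : LieSubalgebra.lieSpan ℂ (gA n R W) s = ⊤) {S : Submodule ℂ (M ψ)}
    (h : ∀ x ∈ s, ∀ w ∈ S, vermaRep ψ x w ∈ S) (u : UgA n R W) {w : M ψ} (hw : w ∈ S) :
    u • w ∈ S := by
  have h1 : ∀ x : gA n R W, ∀ w ∈ S, vermaRep ψ x w ∈ S := by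
    intro x
    have hx : x ∈ LieSubalgebra.lieSpan ℂ (gA n R W) s := hs ▸ LieSubalgebra.mem_top x
    induction hx using LieSubalgebra.lieSpan_induction with
    | mem x hx => exact h x hx
    | zero => intro w _; rw [map_zero]; exact zero_mem _
    | smul c x _ ih => intro w hw; rw [map_smul]; exact S.smul_mem c (ih w hw)
    | add x y _ _ ihx ihy => intro w hw; rw [map_add]; exact add_mem (ihx w hw) (ihy w hw)
    | lie x y _ _ ihx ihy =>
      intro w hw
      rw [LieHom.map_lie]
      exact sub_mem (ihx _ (ihy w hw)) (ihy _ (ihx w hw))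
  let B : Subalgebra ℂ (UgA n R W) :=
    { carrier := {u | ∀ w ∈ S, u • w ∈ S}
      mul_mem' := fun {a b} ha hb w hw => by rw [mul_smul]; exact ha _ (hb w hw)
      add_mem' := fun {a b} ha hb w hw => by rw [add_smul]; exact add_mem (ha w hw) (hb w hw)
      algebraMap_mem' := fun c w hw => by rw [algebraMap_smul]; exact S.smul_mem c hw }
  have hB : B = ⊤ := universalEnvelopingAlgebra_eq_top h1
  exact (hB ▸ Algebra.mem_top : u ∈ B) w hw

variable (hC : IsGCM C) (hW : W ≤ cartan R) (d : loopCartan n R W)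
  (hd : ∀ i, loopRoot n R i d = 1)
include hC hW

/-- The relations hold by construction of the left ideal. Nonvanishing of the generator is not
claimed; it follows later from the map onto an irreducible model. -/
lemma verma_hw (ψ : hA n R W →ₗ[ℂ] ℂ) :
    (loopData d hd).HW (fun x => vermaRep ψ (loopE hC n R W x))
      (fun x => vermaRep ψ (loopF hC n R W x))
      (fun z => vermaRep ψ (loopCartanMap n R W z)) (fun z => ψ (loopCartanMap n R W z))
      (vermaGen ψ) := by
  refine TriData.hw_of_cyclic ((loop_rels hC d hd).map (vermaRep ψ)) (fun x => ?_) (fun z => ?_) ?_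
  · rw [vermaRep_apply, smul_vermaGen]
    exact (Submodule.Quotient.mk_eq_zero _).2
      (Submodule.subset_span (Or.inl ⟨_, loopE_mem_nA hC x, rfl⟩))
  · rw [vermaRep_apply, ← sub_eq_zero, ← algebraMap_smul (UgA n R W) (ψ _) (vermaGen ψ), ← sub_smul,
      smul_vermaGen]
    exact (Submodule.Quotient.mk_eq_zero _).2 (Submodule.subset_span (Or.inr ⟨_, rfl⟩))
  · intro S hv hF hE hH
    rw [eq_top_iff]
    intro w _
    obtain ⟨u, rfl⟩ := exists_smul_vermaGen ψ w
    refine smul_mem_of_lieSpan (loop_lieSpan hC hW) ?_ u hv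
    rintro _ ((⟨x, rfl⟩ | ⟨x, rfl⟩) | ⟨z, rfl⟩)
    · exact hE x
    · exact hF x
    · exact hH z

/-- Any irreducible highest weight module of highest weight `ψ` is isomorphic to `V(ψ)`. -/
theorem exists_V_equiv (ψ : hA n R W →ₗ[ℂ] ℂ) {L : Type*} [AddCommGroup L] [Module ℂ L]
    (ρ : gA n R W →ₗ⁅ℂ⁆ Module.End ℂ L) {v : L}
    (S : (loopData d hd).SimpleHW (fun x => ρ (loopE hC n R W x)) (fun x => ρ (loopF hC n R W x))
      (fun z => ρ (loopCartanMap n R W z)) (fun z => ψ (loopCartanMap n R W z)) v) :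
    ∃ θ : V ψ ≃ₗ[ℂ] L, ∀ y m, θ ⁅y, m⁆ = ρ y (θ m) := by
  let : Module (UgA n R W) L := Module.compHom L (UniversalEnvelopingAlgebra.lift ℂ ρ).toRingHom
  have smul_def : ∀ (u : UgA n R W) (w : L), u • w = UniversalEnvelopingAlgebra.lift ℂ ρ u w :=
    fun _ _ => rfl
  have ι_smul : ∀ (x : gA n R W) (w : L),
      (UniversalEnvelopingAlgebra.ι ℂ x : UgA n R W) • w = ρ x w := fun x w => by
    rw [smul_def, UniversalEnvelopingAlgebra.lift_ι_apply]
  have : IsScalarTower ℂ (UgA n R W) L := ⟨fun c u w => by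
    rw [smul_def, smul_def, map_smul, LinearMap.smul_apply]⟩
  have hker : vermaIdeal ψ ≤ LinearMap.ker (LinearMap.toSpanSingleton (UgA n R W) L v) := by
    rw [vermaIdeal, Submodule.span_le]
    rintro _ (⟨x, hx, rfl⟩ | ⟨h, rfl⟩)
    -- The annihilator of `v` is a subalgebra, so containing the raising generators gives all of `N⁺
    -- ⊗ A`.
    · let G : LieSubalgebra ℂ (gA n R W) :=
        { toSubmodule := LinearMap.ker ((LinearMap.applyₗ (R := ℂ) v) ∘ₗ ρ.toLinearMap)
          lie_mem' := fun {x y} hx hy => by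
            have hx : ρ x v = 0 := hx
            have hy : ρ y v = 0 := hy
            change ρ ⁅x, y⁆ v = 0
            rw [LieHom.map_lie]
            change ρ x (ρ y v) - ρ y (ρ x v) = 0
            rw [hx, hy, map_zero, map_zero, sub_zero] }
      have : ρ x v = 0 := nA_le hC (G := G) S.raise hx
      rw [SetLike.mem_coe, LinearMap.mem_ker, LinearMap.toSpanSingleton_apply, ι_smul, this]
    · obtain ⟨z, rfl⟩ := loopCartanMap_surjective hW h
      rw [SetLike.mem_coe, LinearMap.mem_ker, LinearMap.toSpanSingleton_apply, sub_smul, ι_smul,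
        algebraMap_smul, sub_eq_zero]
      exact S.weight z
  let π : M ψ →ₗ[UgA n R W] L := (vermaIdeal ψ).liftQ _ hker
  have hπ : π (vermaGen ψ) = v := (Submodule.liftQ_apply _ _ _).trans (by simp)
  have hπρ : ∀ y w, π (vermaRep ψ y w) = ρ y (π w) := fun y w => by
    rw [vermaRep_apply, map_smul, ι_smul]
  have hsurj : LinearMap.range π = ⊤ := by
    have h := S.gen ((LinearMap.range π).restrictScalars ℂ) ⟨_, hπ⟩ (by
      rintro x _ ⟨w, rfl⟩
      exact ⟨_, hπρ _ w⟩)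
    exact (Submodule.restrictScalars_eq_top_iff ℂ _ _).1 h
  have hVer := verma_hw hC hW d hd ψ
  have hmax : maxSubmodule ψ = LinearMap.ker π := by
    refine le_antisymm (sSup_le fun N hN m hm => ?_) (le_sSup fun h => ?_)
    · by_contra hne
      have hv : v ∈ (N.map π).restrictScalars ℂ := by
        refine S.mem_of_raise_stable ?_ ((Submodule.ne_bot_iff _).2 ⟨π m, ⟨m, hm, rfl⟩, hne⟩)
        rintro x _ ⟨w, hw, rfl⟩
        exact ⟨_, N.smul_mem _ hw, hπρ _ w⟩
      obtain ⟨w, hw, hwv⟩ := hv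
      -- Some `w = a • vermaGen ψ + u` in `N` maps to `v`. Applying `P(T)` removes `u` and leaves a
      -- multiple of the generator by `a` times a nonzero scalar. If `a ≠ 0`, then `N` is
      -- everything; if `a = 0`, then `v` is the image of `u`, hence off its own eigenvalue. Both
      -- are absurd.
      obtain ⟨a, u, ⟨P, hP, hPu⟩, rfl⟩ := hVer.exists_eq_smul_add w
      change Polynomial.aeval (vermaRep ψ (loopCartanMap n R W d)) P u = 0 at hPu
      set T := vermaRep ψ (loopCartanMap n R W d) with hT
      have hPN : Polynomial.aeval T P (a • vermaGen ψ + u) ∈ N.restrictScalars ℂ :=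
        Polynomial.aeval_apply_smul_mem_of_le_comap (q := N.restrictScalars ℂ) hw P T
          fun w hw => N.smul_mem _ hw
      have hTv : T (vermaGen ψ) = ψ (loopCartanMap n R W d) • vermaGen ψ := hVer.weight d
      rw [map_add, hPu, add_zero, map_smul, Module.End.aeval_apply_of_mem_apply_eq_smul hTv,
        smul_smul] at hPN
      by_cases ha : a = 0
      · refine S.notMem_offEigen ?_
        have := map_mem_offEigen (π := π.restrictScalars ℂ) (hπρ _) ⟨P, hP, hPu⟩
        rw [ha, zero_smul, zero_add] at hwv
        rwa [LinearMap.restrictScalars_apply, hwv] at this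
      · refine hN (eq_top_iff.2 fun w _ => ?_)
        obtain ⟨u, rfl⟩ := exists_smul_vermaGen ψ w
        exact N.smul_mem u (((N.restrictScalars ℂ).smul_mem_iff (mul_ne_zero ha hP)).1 hPN)
    · have : vermaGen ψ ∈ LinearMap.ker π := h ▸ Submodule.mem_top
      exact S.ne_zero (hπ ▸ this)
  let θ : V ψ ≃ₗ[UgA n R W] L := (Submodule.quotEquivOfEq _ _ hmax).trans
    (π.quotKerEquivOfSurjective (LinearMap.range_eq_top.1 hsurj))
  refine ⟨θ.restrictScalars ℂ, fun y m => ?_⟩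
  change θ ((UniversalEnvelopingAlgebra.ι ℂ y : UgA n R W) • m) = ρ y (θ m)
  rw [map_smul, ι_smul]

/-- `V(ψ)` is an irreducible highest weight module. -/
theorem V_simpleHW (ψ : hA n R W →ₗ[ℂ] ℂ) : ∃ v : V ψ, (loopData d hd).SimpleHW
    (fun x => LieModule.toEnd ℂ (gA n R W) (V ψ) (loopE hC n R W x))
    (fun x => LieModule.toEnd ℂ (gA n R W) (V ψ) (loopF hC n R W x))
    (fun z => LieModule.toEnd ℂ (gA n R W) (V ψ) (loopCartanMap n R W z))
    (fun z => ψ (loopCartanMap n R W z)) v := by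
  -- Any linear extension of `ψ` to `𝔤_A` will do: it only certifies that the weight respects linear
  -- relations among diagonal generators.
  obtain ⟨χ, hχ⟩ := LinearMap.exists_extend ψ
  have S := free_simpleHW (loopData d hd) (fun z => ψ (loopCartanMap n R W z))
  obtain ⟨ρ, hE, hF, hH⟩ := S.exists_lieHom (loop_rels hC d hd) (loop_lieSpan hC hW) χ
    fun z => by rw [← hχ]; rfl
  simp only [← hE, ← hF, ← hH] at S
  obtain ⟨θ, hθ⟩ := exists_V_equiv hC hW d hd ψ ρ S
  refine ⟨θ.symm _, S.of_equiv ((loop_rels hC d hd).map (LieModule.toEnd ℂ (gA n R W) (V ψ)))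
    θ.symm ?_ ?_ ?_⟩
  all_goals
    intro x w
    rw [LinearEquiv.symm_apply_eq]
    simp [hθ]

/-! ### Vanishing modulo an ideal and the tensor product decomposition. -/

omit hC hW in
/-- If `ψ(𝔥' ⊗ I) = 0`, then the generators with coefficient in `I` act by zero. -/
lemma generators_eq_zero {ψ : hA n R W →ₗ[ℂ] ℂ} {I : Ideal (Laurent n)}
    (hψ : ∀ h : cartan' R, ∀ p ∈ I, ψ (hTensor W h p) = 0)
    {L : Type*} [AddCommGroup L] [Module ℂ L] {E F : ι × Laurent n → Module.End ℂ L}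
    {T : loopCartan n R W → Module.End ℂ L} {v : L}
    (S : (loopData d hd).SimpleHW E F T (fun z => ψ (loopCartanMap n R W z)) v)
    {i : ι} {p : Laurent n} (hp : p ∈ I) : E (i, p) = 0 ∧ F (i, p) = 0 := by
  have ht : ∀ x y : ι × Laurent n, x.2 * y.2 ∈ I →
      (∀ i, loopRoot n R i ((loopData d hd).t x y) ∈ I) ∧
        ψ (loopCartanMap n R W ((loopData d hd).t x y)) = 0 := by
    intro x y hxy
    simp only [loopData]
    split_ifs
    · refine ⟨fun i => ?_, hψ ⟨_, kmH_coroot_mem_cartan' x.1⟩ _ hxy⟩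
      rw [loopCoroot, loopRoot_tmul]
      exact Submodule.smul_of_tower_mem I _ hxy
    · simp
  -- `Y` requires root values in `I`, so that its elements send every index into the set of indices
  -- with coefficient in `I`.
  exact S.eq_zero_of_mem (S := {x | x.2 ∈ I})
    (Y := {z | (∀ i, loopRoot n R i z ∈ I) ∧ ψ (loopCartanMap n R W z) = 0})
    (fun z x hx => I.mul_mem_left _ hx) (fun z hz x => I.mul_mem_right _ (hz.1 x.1))
    (fun z hz => hz.2) (fun x y hy => ht x y (I.mul_mem_left _ hy))
    (fun x hx y => ht x y (I.mul_mem_right _ hx)) (i, p) hp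

omit hW in
/-- Complementary highest weights give a tensor product decomposition. -/
theorem nonempty_V_add_equiv (hsup : cartan' R ⊔ W = cartan R) {I₁ I₂ : Ideal (Laurent n)}
    (hcop : I₁ ⊔ I₂ = ⊤) {ψ₁ ψ₂ : hA n R W →ₗ[ℂ] ℂ}
    (hψ₁ : ∀ h : cartan' R, ∀ p ∈ I₁, ψ₁ (hTensor W h p) = 0)
    (hψ₂ : ∀ h : cartan' R, ∀ p ∈ I₂, ψ₂ (hTensor W h p) = 0) :
    Nonempty (V (ψ₁ + ψ₂) ≃ₗ⁅ℂ, gA n R W⁆ (V ψ₁ ⊗[ℂ] V ψ₂)) := by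
  have hW : W ≤ cartan R := hsup ▸ le_sup_right
  obtain ⟨d, hd⟩ := exists_loopCartan_root_eq_one (n := n) hsup.ge
  obtain ⟨v₁, S₁⟩ := V_simpleHW hC hW d hd ψ₁
  obtain ⟨v₂, S₂⟩ := V_simpleHW hC hW d hd ψ₂
  have h₁ : ∀ i, ∀ p ∈ I₁, _ := fun i p hp =>
    generators_eq_zero d hd hψ₁ S₁ (i := i) hp
  have h₂ : ∀ i, ∀ p ∈ I₂, _ := fun i p hp =>
    generators_eq_zero d hd hψ₂ S₂ (i := i) hp
  have hE : ∀ i p q, loopE hC n R W (i, p + q) =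
      loopE hC n R W (i, p) + loopE hC n R W (i, q) :=
    fun i p q => Subtype.ext (TensorProduct.add_tmul p q _)
  have hF : ∀ i p q, loopF hC n R W (i, p + q) =
      loopF hC n R W (i, p) + loopF hC n R W (i, q) :=
    fun i p q => Subtype.ext (TensorProduct.add_tmul p q _)
  -- For `p = a + b`, the index `(i, b)` acts as `(i, p)` on `V ψ₁`, where `a` acts by zero, and by
  -- zero on `V ψ₂`; symmetrically for `(i, a)`.
  have hdec : ∀ p : Laurent n, ∃ a ∈ I₁, ∃ b ∈ I₂, a + b = p := fun p =>
    Submodule.mem_sup.1 (hcop ▸ Submodule.mem_top)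
  have S := S₁.tensor S₂
    ((loop_rels hC d hd).map (LieModule.toEnd ℂ (gA n R W)
      (V ψ₁ ⊗[ℂ] V ψ₂)))
    (fun x => toEnd_tensor _) (fun x => toEnd_tensor _)
    (fun x => toEnd_tensor _)
    (by
      rintro ⟨i, p⟩
      obtain ⟨a, ha, b, hb, rfl⟩ := hdec p
      exact ⟨(i, b), by simp [hE, (h₁ i a ha).1], by simp [hF, (h₁ i a ha).2], h₂ i b hb⟩)
    (by
      rintro ⟨i, p⟩
      obtain ⟨a, ha, b, hb, rfl⟩ := hdec p
      exact ⟨(i, a), by simp [hE, (h₂ i b hb).1], by simp [hF, (h₂ i b hb).2], h₁ i a ha⟩)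
  obtain ⟨θ, hθ⟩ := exists_V_equiv hC hW d hd (ψ₁ + ψ₂) _ S
  exact ⟨{ θ with map_lie' := fun {x m} => hθ x m }⟩

end

end LoopKacMoody

end

theorem proposition3p8
    -- a Kac-Moody algebra `𝔤`: a generalized Cartan matrix and a realization of it
    {ι : Type*} [Fintype ι] [DecidableEq ι] (C : Matrix ι ι ℤ) (hC : LoopKacMoody.IsGCM C)
    {H : Type*} [AddCommGroup H] [Module ℂ H] (R : LoopKacMoody.Realization C H)
    -- a complement `𝔥''` of `𝔥'` in `𝔥`
    (H'' : Submodule ℂ (LoopKacMoody.KM R))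
    (hdisj : LoopKacMoody.cartan' R ⊓ H'' = ⊥)
    (hsup : LoopKacMoody.cartan' R ⊔ H'' = LoopKacMoody.cartan R)
    -- coprime cofinite ideals of the ring of Laurent polynomials in `n` variables
    (n : ℕ) (I₁ I₂ : Ideal (LoopKacMoody.Laurent n))
    (hfin₁ : Module.Finite ℂ (LoopKacMoody.Laurent n ⧸ I₁))
    (hfin₂ : Module.Finite ℂ (LoopKacMoody.Laurent n ⧸ I₂))
    (hcop : I₁ ⊔ I₂ = ⊤)
    (ψ₁ ψ₂ : LoopKacMoody.hA n R H'' →ₗ[ℂ] ℂ)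
    (hψ₁ : ∀ h : LoopKacMoody.cartan' R, ∀ p ∈ I₁, ψ₁ (LoopKacMoody.hTensor H'' h p) = 0)
    (hψ₂ : ∀ h : LoopKacMoody.cartan' R, ∀ p ∈ I₂, ψ₂ (LoopKacMoody.hTensor H'' h p) = 0) :
    Nonempty (LoopKacMoody.V (ψ₁ + ψ₂) ≃ₗ⁅ℂ, LoopKacMoody.gA n R H''⁆
      (LoopKacMoody.V ψ₁ ⊗[ℂ] LoopKacMoody.V ψ₂)) := by
  exact LoopKacMoody.nonempty_V_add_equiv hC hsup hcop hψ₁ hψ₂
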